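/- Let $m=(m_k)_{k\ge 0}$ be a bounded sequence of integers $m_k\ge 2$, let $G_m=\prod_{k\ge0}\mathbb Z/m_k\mathbb Z$ be the corresponding (bounded) Vilenkin group with coordinatewise addition, and let $\mu$ be its normalized Haar measure, i.e. the product of the uniform probability measures on the factors; on $G_m\times G_m$ write $d\mu(t,u)$ for the product measure $\mu\times\mu$. Put $M_0=1$, $M_{k+1}=m_kM_k$, and write every $n\in\mathbb N=\{0,1,2,\dots\}$ uniquely as $n=\sum_{k}n_kM_k$ with $0\le n_k<m_k$. For $x\in G_m$, with coordinates $x_k\in\{0,\dots,m_k-1\}$, let $r_k(x)=\exp(2\pi\imath x_k/m_k)$ and $\psi_n(x)=\prod_{k\ge0}r_k(x)^{n_k}$. For $x\in G_m$ and $n\in\mathbb N$ let $I_n(x)=\{y\in G_m: y_i=x_i \text{ for } 0\le i<n\}$ and $I_n=I_n(0)$; let $e_n\in G_m$ be the element whose $n$th coordinate is $1$ and whose other coordinates are $0$. For $f\in L_1(G_m\times G_m)$ (complex-valued, with a fixed everywhere defined representative) let $$\widehat f(i,j)=\int_{G_m\times G_m}f(t,u)\,\overline{\psi_i(t)\psi_j(u)}\,d\mu(t,u),\qquad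 S_{A,B}(x,y;f)=\sum_{i=0}^{A-1}\sum_{j=0}^{B-1}\widehat f(i,j)\psi_i(x)\psi_j(y),$$ $$\sigma_n(x,y;f)=\frac1n\sum_{j=0}^{n-1}S_{j,j}(x,y;f)\qquad(n\ge1).$$ With $r_{i,n}(t,u)=\prod_{l=i}^{n}\Bigl(\sum_{s=0}^{m_l-1}\psi_{M_l}(t+u)^s\Bigr)$ (an empty product being $1$) and $F(t,u)=|f(x-t,y-u)-f(x,y)|$, define $$\begin{aligned}W_j(x,y;f)={}&\frac1{M_j}\sum_{q=0}^{j-1}\sum_{k=q}^{j-1}\sum_{u_q=1}^{m_q-1}M_qM_k^2\int_{I_k\times I_k(u_qe_q)}F(t,u)\,r_{k+1,j-1}(t,u)\,d\mu(t,u)\\&+\frac1{M_j}\sum_{q=0}^{j-1}\sum_{k=q}^{j-1}\sum_{t_q=1}^{m_q-1}M_qM_k^2\int_{I_k(t_qe_q)\times I_k}F(t,u)\,r_{k+1,j-1}(t,u)\,d\mu(t,u)\\&+\sum_{s=0}^{j}\sum_{i=s}^{j}M_sM_i\sum_{u_s=1}^{m_s-1}\int_{I_j\times I_i(u_se_s)}F(t,u)\,d\mu(t,u)\\&+\sum_{s=0}^{j}\sum_{i=s}^{j}M_sM_i\sum_{t_s=1}^{m_s-1}\int_{I_i(t_se_s)\times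 I_j}F(t,u)\,d\mu(t,u).\end{aligned}$$ A point $(x,y)\in G_m\times G_m$ is called a Marcinkiewicz-Lebesgue point of $f$ if $\lim_{n\to\infty}W_n(x,y;f)=0$. Theorem. For every $f\in L_1(G_m\times G_m)$ and every Marcinkiewicz-Lebesgue point $(x,y)$ of $f$, $$\lim_{n\to\infty}\sigma_n(x,y;f)=f(x,y).$$ -/

import Mathlib

open MeasureTheory Filter Topology

/-- The Vilenkin group `G_m`: the complete direct product of the cyclic groups `ℤ / m_k ℤ`,
with coordinatewise addition. -/
abbrev VilenkinGroup (m : ℕ → ℕ) : Type := (k : ℕ) → ZMod (m k)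

namespace Vilenkin

noncomputable section

/-- The normalized Haar measure on `G_m`: the product of the measures on `ℤ / m_k ℤ` giving mass
`1 / m_k` to every point. -/
def haar (m : ℕ → ℕ) : Measure (VilenkinGroup m) :=
  Measure.infinitePi fun k => ((m k : ENNReal)⁻¹ • (Measure.count : Measure (ZMod (m k))))

/-- The normalized Haar measure on `G_m × G_m`. -/
def haar₂ (m : ℕ → ℕ) : Measure (VilenkinGroup m × VilenkinGroup m) :=
  (haar m).prod (haar m)

/-- The generalized powers `M_0 = 1`, `M_{k+1} = m_k M_k`. -/
def M (m : ℕ → ℕ) : ℕ → ℕ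
  | 0 => 1
  | k + 1 => m k * M m k

/-- The `k`-th digit `n_k ∈ {0, …, m_k - 1}` in the expansion `n = ∑ n_k M_k`. -/
def digit (m : ℕ → ℕ) (n k : ℕ) : ℕ := n / M m k % m k

/-- The cylinder `I_n(x)` of the points whose first `n` coordinates agree with those of `x`. -/
def I (m : ℕ → ℕ) (n : ℕ) (x : VilenkinGroup m) : Set (VilenkinGroup m) :=
  {y | ∀ i < n, y i = x i}

/-- The element `e_n` with `n`-th coordinate `1` and all other coordinates `0`. -/
def e (m : ℕ → ℕ) (n : ℕ) : VilenkinGroup m := Pi.single n 1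

/-- The generalized Rademacher functions `r_k(x) = exp (2 π i x_k / m_k)`, where `x_k` is
represented in `{0, …, m_k - 1}`. -/
def rademacher (m : ℕ → ℕ) (k : ℕ) (x : VilenkinGroup m) : ℂ :=
  Complex.exp (2 * Real.pi * Complex.I * ((x k).val : ℂ) / (m k : ℂ))

/-- The Vilenkin functions `ψ_n = ∏_k r_k ^ {n_k}` (only finitely many factors differ from `1`). -/
def psi (m : ℕ → ℕ) (n : ℕ) (x : VilenkinGroup m) : ℂ :=
  ∏ᶠ k : ℕ, rademacher m k x ^ digit m n k

/-- The Vilenkin-Fourier coefficients of `f` with respect to `ψ_i(x) ψ_j(y)`. -/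
def fourierCoeff (m : ℕ → ℕ) (f : VilenkinGroup m × VilenkinGroup m → ℂ) (i j : ℕ) : ℂ :=
  ∫ p, f p * (starRingEnd ℂ) (psi m i p.1 * psi m j p.2) ∂(haar₂ m)

/-- The rectangular partial sums `S_{A,B}(x, y; f)`. -/
def partialSum (m : ℕ → ℕ) (f : VilenkinGroup m × VilenkinGroup m → ℂ) (A B : ℕ)
    (x y : VilenkinGroup m) : ℂ :=
  ∑ i ∈ Finset.range A, ∑ j ∈ Finset.range B, fourierCoeff m f i j * psi m i x * psi m j y

/-- The Marcinkiewicz-Fejér means `σ_n(x, y; f) = (1 / n) ∑_{j < n} S_{j,j}(x, y; f)`. -/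
def sigma (m : ℕ → ℕ) (f : VilenkinGroup m × VilenkinGroup m → ℂ) (n : ℕ)
    (x y : VilenkinGroup m) : ℂ :=
  (1 / (n : ℂ)) * ∑ j ∈ Finset.range n, partialSum m f j j x y

/-- `r_{i,n}(x, y) = ∏_{l=i}^{n} ∑_{s < m_l} ψ_{M_l}(x + y) ^ s`, an empty product being `1`. -/
def rProd (m : ℕ → ℕ) (i n : ℕ) (x y : VilenkinGroup m) : ℂ :=
  ∏ l ∈ Finset.Icc i n, ∑ s ∈ Finset.range (m l), psi m (M m l) (x + y) ^ s

/-- The functional `W_j(x, y; f)`. The factors `r_{k+1,j-1}` are written as complex numbers,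
so that the value is formally complex. -/
def W (m : ℕ → ℕ) (f : VilenkinGroup m × VilenkinGroup m → ℂ) (j : ℕ)
    (x y : VilenkinGroup m) : ℂ :=
  (M m j : ℂ)⁻¹ * (∑ q ∈ Finset.range j, ∑ k ∈ Finset.Ico q j, ∑ u ∈ Finset.Ico 1 (m q),
      (M m q : ℂ) * (M m k : ℂ) ^ 2 *
        ∫ p in I m k 0 ×ˢ I m k (u • e m q),
          ((‖f (x - p.1, y - p.2) - f (x, y)‖ : ℝ) : ℂ) * rProd m (k + 1) (j - 1) p.1 p.2
            ∂(haar₂ m))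
  + (M m j : ℂ)⁻¹ * (∑ q ∈ Finset.range j, ∑ k ∈ Finset.Ico q j, ∑ t ∈ Finset.Ico 1 (m q),
      (M m q : ℂ) * (M m k : ℂ) ^ 2 *
        ∫ p in I m k (t • e m q) ×ˢ I m k 0,
          ((‖f (x - p.1, y - p.2) - f (x, y)‖ : ℝ) : ℂ) * rProd m (k + 1) (j - 1) p.1 p.2
            ∂(haar₂ m))
  + (∑ s ∈ Finset.range (j + 1), ∑ i ∈ Finset.Icc s j, ∑ u ∈ Finset.Ico 1 (m s),
      (M m s : ℂ) * (M m i : ℂ) *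
        ∫ p in I m j 0 ×ˢ I m i (u • e m s),
          ((‖f (x - p.1, y - p.2) - f (x, y)‖ : ℝ) : ℂ) ∂(haar₂ m))
  + (∑ s ∈ Finset.range (j + 1), ∑ i ∈ Finset.Icc s j, ∑ t ∈ Finset.Ico 1 (m s),
      (M m s : ℂ) * (M m i : ℂ) *
        ∫ p in I m i (t • e m s) ×ˢ I m j 0,
          ((‖f (x - p.1, y - p.2) - f (x, y)‖ : ℝ) : ℂ) ∂(haar₂ m))

/-- `(x, y)` is a Marcinkiewicz-Lebesgue point of `f` if `W_n(x, y; f) → 0`. -/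
def IsMarcinkiewiczLebesguePoint (m : ℕ → ℕ) (f : VilenkinGroup m × VilenkinGroup m → ℂ)
    (x y : VilenkinGroup m) : Prop :=
  Tendsto (fun n : ℕ => W m f n x y) atTop (𝓝 0)

end

end Vilenkin

/-! Since $\int D_j\,d\mu = 1$ for $j \ge 1$ and $D_0 = 0$, the error $\sigma_n - f(x,y)$ is $1/n$
times the integral of $f(x-t,y-u)-f(x,y)$ against $K_n = \sum_{j<n} D_j(t)D_j(u)$, minus $f(x,y)/n$
(`sigma_sub_eq`). The core is a pointwise bound (`norm_marcSum_le`): for $n < M_N$, $|K_n|$ is at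
most a constant times $\sum_{A<N} M_A w_A$, where $w_A \ge 0$ is the kernel whose integral against
$F$ is $W_A$ (`W_eq_integral`). Hence the error is at most $C n^{-1}\sum_{A<N} M_A W_A +
|f(x,y)|/n$. Choosing $N$ minimal gives $\sum_{A<N} M_A \le 2M_{N-1} \le 2n$, so $W_A \to 0$ makes
this weighted mean vanish (`tendsto_weighted_mean`).

For the kernel bound, cut $[0,n)$ along its mixed-radix digits into blocks $[cM_A,(c+1)M_A)$. There
$D_{cM_A+i} = D_{cM_A} + \psi_{cM_A}D_i$, and expanding the product (`sum_block`) leaves terms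
containing $D_{cM_A}$ and the term $\psi_{cM_A}(t+u)K_{M_A}$. The recursion for $K_{M_A}$ sums
characters in $t+u$, which produces the products $r_{k+1,j-1}$ of the first two terms of $W$
(`norm_marcSum_M_le`). The other terms are controlled by one-dimensional Fejér bounds and tails of
$\sum_l M_l 1_{I_l}$; changing the order of summation turns them into the last two terms of $W$. -/

namespace Vilenkin

/-! ### Mixed-radix digits and the Vilenkin characters. -/

section Characters

variable {m : ℕ → ℕ}

theorem M_succ (m : ℕ → ℕ) (k : ℕ) : M m (k + 1) = m k * M m k := rfl

theorem M_pos (hm : ∀ k, 2 ≤ m k) (k : ℕ) : 0 < M m k := by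
  induction k with
  | zero => simp [M]
  | succ k ih => rw [M_succ]; have := hm k; positivity

theorem two_mul_M_le (hm : ∀ k, 2 ≤ m k) (k : ℕ) : 2 * M m k ≤ M m (k + 1) := by
  rw [M_succ]; exact Nat.mul_le_mul_right _ (hm k)

theorem M_dvd {k l : ℕ} (h : k ≤ l) : M m k ∣ M m l := by
  induction l, h using Nat.le_induction with
  | base => exact dvd_rfl
  | succ l _ ih => exact ih.trans (Dvd.intro_left _ rfl)

theorem M_mono (hm : ∀ k, 2 ≤ m k) : Monotone (M m) := fun _ l h =>
  Nat.le_of_dvd (M_pos hm l) (M_dvd h)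

theorem lt_M (hm : ∀ k, 2 ≤ m k) (n : ℕ) : n < M m n := by
  induction n with
  | zero => simp [M]
  | succ n ih => have := two_mul_M_le hm n; omega

theorem sum_M_le (hm : ∀ k, 2 ≤ m k) (n : ℕ) :
    ∑ k ∈ Finset.range (n + 1), M m k ≤ 2 * M m n := by
  induction n with
  | zero => simp [M]
  | succ n ih => rw [Finset.sum_range_succ]; have := two_mul_M_le hm n; omega

theorem digit_eq_zero (hm : ∀ k, 2 ≤ m k) {n N k : ℕ} (hn : n < M m N) (hk : N ≤ k) :
    digit m n k = 0 := by
  rw [digit, Nat.div_eq_of_lt (hn.trans_le (M_mono hm hk)), Nat.zero_mod]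

/-- No carry occurs: the multiple of $M_A$ has zero digits below $A$, and $i$ has zero digits from
$A$ on. -/
theorem digit_mul_add (hm : ∀ k, 2 ≤ m k) {A i : ℕ} (c : ℕ) (hi : i < M m A) (k : ℕ) :
    digit m (c * M m A + i) k = digit m (c * M m A) k + digit m i k := by
  rcases lt_or_ge k A with h | h
  · obtain ⟨d, hd⟩ := M_dvd (m := m) (Nat.succ_le_of_lt h)
    have e1 : c * M m A = M m k * (m k * (c * d)) := by
      rw [hd, Nat.succ_eq_add_one, M_succ]; ring
    rw [digit, digit, digit, e1, Nat.mul_add_div (M_pos hm k),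
      Nat.mul_div_cancel_left _ (M_pos hm k), Nat.mul_add_mod, Nat.mul_mod_right, zero_add]
  · rw [digit_eq_zero hm hi h, add_zero]
    obtain ⟨d, hd⟩ := M_dvd (m := m) h
    rw [digit, digit, hd, ← Nat.div_div_eq_div_mul, ← Nat.div_div_eq_div_mul,
      Nat.mul_div_cancel _ (M_pos hm A), mul_comm c, Nat.mul_add_div (M_pos hm A),
      Nat.div_eq_of_lt hi, add_zero]

theorem digit_mul_M (hm : ∀ k, 2 ≤ m k) {A c : ℕ} (hc : c < m A) (k : ℕ) :
    digit m (c * M m A) k = if k = A then c else 0 := by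
  split_ifs with h
  · subst h
    rw [digit, Nat.mul_div_cancel _ (M_pos hm k), Nat.mod_eq_of_lt hc]
  · rcases lt_or_gt_of_ne h with h | h
    · obtain ⟨d, hd⟩ := M_dvd (m := m) (Nat.succ_le_of_lt h)
      have e1 : c * M m A = M m k * (m k * (c * d)) := by
        rw [hd, Nat.succ_eq_add_one, M_succ]; ring
      rw [digit, e1, Nat.mul_div_cancel_left _ (M_pos hm k), Nat.mul_mod_right]
    · refine digit_eq_zero hm (N := A + 1) ?_ h
      rw [M_succ]
      exact Nat.mul_lt_mul_of_pos_right hc (M_pos hm A)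

theorem exists_digit_ne_zero (hm : ∀ k, 2 ≤ m k) {N n : ℕ} (hn : n ≠ 0) (hN : n < M m N) :
    ∃ k, digit m n k ≠ 0 := by
  induction N with
  | zero => simp [M] at hN; omega
  | succ N ih =>
    by_cases h : n < M m N
    · exact ih h
    · refine ⟨N, ?_⟩
      rw [M_succ] at hN
      have h1 : n / M m N < m N := (Nat.div_lt_iff_lt_mul (M_pos hm N)).2 hN
      have h2 : 0 < n / M m N := Nat.div_pos (not_lt.1 h) (M_pos hm N)
      rw [digit, Nat.mod_eq_of_lt h1]
      exact h2.ne'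

theorem neZero (hm : ∀ k, 2 ≤ m k) (k : ℕ) : NeZero (m k) := ⟨by have := hm k; omega⟩

theorem rademacher_eq_stdAddChar (k : ℕ) [NeZero (m k)] (x : VilenkinGroup m) :
    rademacher m k x = ZMod.stdAddChar (x k) := by
  rw [ZMod.stdAddChar_apply, ZMod.toCircle_apply, rademacher]

theorem rademacher_add (hm : ∀ k, 2 ≤ m k) (k : ℕ) (x y : VilenkinGroup m) :
    rademacher m k (x + y) = rademacher m k x * rademacher m k y := by
  have := neZero hm k
  simp only [rademacher_eq_stdAddChar, Pi.add_apply, AddChar.map_add_eq_mul]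

theorem norm_rademacher (hm : ∀ k, 2 ≤ m k) (k : ℕ) (x : VilenkinGroup m) :
    ‖rademacher m k x‖ = 1 := by
  have := neZero hm k
  rw [rademacher_eq_stdAddChar, ZMod.stdAddChar_apply, Circle.norm_coe]

theorem sum_rademacher_pow (hm : ∀ k, 2 ≤ m k) (k : ℕ) (x : VilenkinGroup m) :
    ∑ s ∈ Finset.range (m k), rademacher m k x ^ s = if x k = 0 then (m k : ℂ) else 0 := by
  have := neZero hm k
  rw [rademacher_eq_stdAddChar]
  split_ifs with h
  · simp [h]
  · have h1 : ZMod.stdAddChar (x k) ≠ 1 := by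
      intro h2
      rw [← AddChar.map_zero_eq_one (ZMod.stdAddChar (N := m k))] at h2
      exact h (ZMod.injective_stdAddChar h2)
    -- The numerator of the geometric sum vanishes because $m_k x_k = 0$ in $\mathbb Z/m_k\mathbb
    -- Z$.
    rw [geom_sum_eq h1, ← AddChar.map_nsmul_eq_pow]
    simp

theorem psi_eq_prod (hm : ∀ k, 2 ≤ m k) {n N : ℕ} (hn : n < M m N) (x : VilenkinGroup m) :
    psi m n x = ∏ k ∈ Finset.range N, rademacher m k x ^ digit m n k := by
  refine finprod_eq_prod_of_mulSupport_subset _ fun k hk => ?_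
  by_contra h
  simp only [Finset.coe_range, Set.mem_Iio, not_lt] at h
  exact hk (by simp [digit_eq_zero hm hn h])

theorem psi_zero (hm : ∀ k, 2 ≤ m k) (x : VilenkinGroup m) : psi m 0 x = 1 := by
  rw [psi_eq_prod hm (N := 0) (by simp [M])]; simp

theorem psi_add (hm : ∀ k, 2 ≤ m k) (n : ℕ) (x y : VilenkinGroup m) :
    psi m n (x + y) = psi m n x * psi m n y := by
  simp only [psi_eq_prod hm (lt_M hm n), rademacher_add hm, mul_pow, Finset.prod_mul_distrib]

theorem norm_psi (hm : ∀ k, 2 ≤ m k) (n : ℕ) (x : VilenkinGroup m) : ‖psi m n x‖ = 1 := by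
  simp only [psi_eq_prod hm (lt_M hm n), norm_prod, norm_pow, norm_rademacher hm, one_pow,
    Finset.prod_const_one]

theorem psi_mul_conj (hm : ∀ k, 2 ≤ m k) (n : ℕ) (x : VilenkinGroup m) :
    psi m n x * (starRingEnd ℂ) (psi m n x) = 1 := by
  rw [Complex.mul_conj, Complex.normSq_eq_norm_sq, norm_psi hm]; simp

theorem psi_sub (hm : ∀ k, 2 ≤ m k) (n : ℕ) (x t : VilenkinGroup m) :
    psi m n (x - t) = psi m n x * (starRingEnd ℂ) (psi m n t) := by
  have h : psi m n x = psi m n (x - t) * psi m n t := by rw [← psi_add hm, sub_add_cancel]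
  rw [h, mul_assoc, psi_mul_conj hm, mul_one]

theorem psi_mul_add (hm : ∀ k, 2 ≤ m k) {A i : ℕ} (c : ℕ) (hi : i < M m A)
    (x : VilenkinGroup m) :
    psi m (c * M m A + i) x = psi m (c * M m A) x * psi m i x := by
  have h1 := lt_M hm (c * M m A + i)
  rw [psi_eq_prod hm h1, psi_eq_prod hm ((Nat.le_add_right _ i).trans_lt h1),
    psi_eq_prod hm ((Nat.le_add_left i _).trans_lt h1), ← Finset.prod_mul_distrib]
  simp only [digit_mul_add hm c hi, pow_add]

theorem psi_mul_M (hm : ∀ k, 2 ≤ m k) {A c : ℕ} (hc : c < m A) (x : VilenkinGroup m) :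
    psi m (c * M m A) x = rademacher m A x ^ c := by
  rw [psi, finprod_eq_single _ A]
  · rw [digit_mul_M hm hc, if_pos rfl]
  · intro k hk
    rw [digit_mul_M hm hc, if_neg hk, pow_zero]

theorem psi_M (hm : ∀ k, 2 ≤ m k) (A : ℕ) (x : VilenkinGroup m) :
    psi m (M m A) x = rademacher m A x := by
  have := psi_mul_M hm (A := A) (c := 1) (by have := hm A; omega) x
  simpa using this

/-- At $e_k$, with $n_k \ne 0$, the value is $\exp(2\pi i n_k/m_k)$ and $0 < n_k < m_k$. This
nontriviality drives the orthogonality in `integral_psi`. -/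
theorem exists_psi_ne_one (hm : ∀ k, 2 ≤ m k) {n : ℕ} (hn : n ≠ 0) :
    ∃ z : VilenkinGroup m, psi m n z ≠ 1 := by
  obtain ⟨k, hk⟩ := exists_digit_ne_zero hm hn (lt_M hm n)
  have := neZero hm k
  refine ⟨e m k, ?_⟩
  rw [psi, finprod_eq_single _ k]
  · rw [rademacher_eq_stdAddChar, ← AddChar.map_nsmul_eq_pow, e, Pi.single_eq_same]
    intro h
    rw [← AddChar.map_zero_eq_one (ZMod.stdAddChar (N := m k))] at h
    have h2 := ZMod.injective_stdAddChar h
    rw [nsmul_one, ZMod.natCast_eq_zero_iff] at h2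
    have h3 : digit m n k < m k := Nat.mod_lt _ (by have := hm k; omega)
    exact absurd (Nat.le_of_dvd (Nat.pos_of_ne_zero hk) h2) (not_le.2 h3)
  · intro l hl
    have := neZero hm l
    rw [rademacher_eq_stdAddChar, e, Pi.single_eq_of_ne hl, AddChar.map_zero_eq_one, one_pow]

end Characters

end Vilenkin

namespace Vilenkin

/-! ### Cylinder majorants and the kernels of order $M_A$. -/

noncomputable section Kernels

/-- The indicator function of the cylinder `I_k(z)`. -/
def cyl (m : ℕ → ℕ) (k : ℕ) (z t : VilenkinGroup m) : ℝ := (I m k z).indicator 1 t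

/-- The Dirichlet kernels `D_n = ∑_{i < n} ψ_i`. -/
def dirichlet (m : ℕ → ℕ) (n : ℕ) (t : VilenkinGroup m) : ℂ :=
  ∑ i ∈ Finset.range n, psi m i t

/-- The sum of the first `M_A` Dirichlet kernels. -/
def fejerSum (m : ℕ → ℕ) (A : ℕ) (t : VilenkinGroup m) : ℂ :=
  ∑ i ∈ Finset.range (M m A), dirichlet m i t

/-- `n` times the Marcinkiewicz-Fejér kernel. -/
def marcSum (m : ℕ → ℕ) (n : ℕ) (t u : VilenkinGroup m) : ℂ :=
  ∑ j ∈ Finset.range n, dirichlet m j t * dirichlet m j u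

/-- The real value of the character sum `∑_{s < m_l} r_l(x)^s`. -/
def rFactor (m : ℕ → ℕ) (l : ℕ) (x : VilenkinGroup m) : ℝ := if x l = 0 then m l else 0

/-- The majorant of the Fejér kernel of order `M_A`. -/
def fejerMaj (m : ℕ → ℕ) (A : ℕ) (u : VilenkinGroup m) : ℝ :=
  ∑ q ∈ Finset.range (A + 1), ∑ v ∈ Finset.Ico 1 (m q), (M m q : ℝ) * cyl m A (v • e m q) u

/-- The kernel of the third term of `W_j`. -/
def sideKernel (m : ℕ → ℕ) (j : ℕ) (t u : VilenkinGroup m) : ℝ :=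
  cyl m j 0 t * ∑ i ∈ Finset.range (j + 1), (M m i : ℝ) * fejerMaj m i u

/-- `M_j` times a majorant of the kernel of the first term of `W_j`. -/
def diagKernel (m : ℕ → ℕ) (j : ℕ) (t u : VilenkinGroup m) : ℝ :=
  ∑ k ∈ Finset.range j, (M m k : ℝ) ^ 2 * (cyl m k 0 t * fejerMaj m k u) *
    ∏ l ∈ Finset.Ico (k + 1) j, rFactor m l (t + u)

variable {m : ℕ → ℕ}

theorem cyl_nonneg (k : ℕ) (z t : VilenkinGroup m) : 0 ≤ cyl m k z t :=
  Set.indicator_nonneg (fun _ _ => zero_le_one) _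

theorem cyl_le_one (k : ℕ) (z t : VilenkinGroup m) : cyl m k z t ≤ 1 := by
  exact Set.indicator_apply_le' (fun _ => le_rfl) (fun _ => zero_le_one)

theorem cyl_zero (z t : VilenkinGroup m) : cyl m 0 z t = 1 :=
  Set.indicator_of_mem (by simp [I]) _

theorem cyl_succ (k : ℕ) (z t : VilenkinGroup m) :
    cyl m (k + 1) z t = cyl m k z t * if t k = z k then 1 else 0 := by
  classical
  have h : t ∈ I m (k + 1) z ↔ t ∈ I m k z ∧ t k = z k := Nat.forall_lt_succ_right
  simp only [cyl, Set.indicator_apply, h, Pi.one_apply]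
  split_ifs <;> simp_all

theorem cyl_congr {k : ℕ} {z z' : VilenkinGroup m} (h : ∀ i < k, z i = z' i)
    (t : VilenkinGroup m) : cyl m k z t = cyl m k z' t := by
  have : I m k z = I m k z' := by
    ext y
    exact forall₂_congr fun i hi => by rw [h i hi]
  rw [cyl, cyl, this]

theorem smul_e_apply_of_ne {q i : ℕ} (h : i ≠ q) (v : ℕ) : (v • e m q) i = 0 := by
  simp [e, Pi.single_eq_of_ne h]

theorem smul_e_apply_self (q v : ℕ) : (v • e m q) q = (v : ZMod (m q)) := by
  simp [e]

theorem cyl_smul_e_self (k v : ℕ) (t : VilenkinGroup m) :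
    cyl m k (v • e m k) t = cyl m k 0 t :=
  cyl_congr (fun _ hi => smul_e_apply_of_ne hi.ne v) t

theorem rFactor_nonneg (l : ℕ) (x : VilenkinGroup m) : 0 ≤ rFactor m l x := by
  rw [rFactor]; split_ifs <;> positivity

theorem sum_rademacher_pow_eq_rFactor (hm : ∀ k, 2 ≤ m k) (l : ℕ) (x : VilenkinGroup m) :
    ∑ s ∈ Finset.range (m l), rademacher m l x ^ s = (rFactor m l x : ℂ) := by
  rw [sum_rademacher_pow hm, rFactor]; split_ifs <;> simp

theorem fejerMaj_nonneg (A : ℕ) (u : VilenkinGroup m) : 0 ≤ fejerMaj m A u :=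
  Finset.sum_nonneg fun _ _ => Finset.sum_nonneg fun _ _ =>
    mul_nonneg (Nat.cast_nonneg _) (cyl_nonneg _ _ _)

theorem sideKernel_nonneg (j : ℕ) (t u : VilenkinGroup m) : 0 ≤ sideKernel m j t u :=
  mul_nonneg (cyl_nonneg _ _ _) (Finset.sum_nonneg fun _ _ =>
    mul_nonneg (Nat.cast_nonneg _) (fejerMaj_nonneg _ _))

/-- $I_A$ does not see coordinate $A$, so the summands with $q = A$ are $m_A - 1$ copies of the
indicator of $I_A(0)$. -/
theorem fejerMaj_eq_add (hm : ∀ k, 2 ≤ m k) (A : ℕ) (u : VilenkinGroup m) :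
    fejerMaj m A u = (∑ q ∈ Finset.range A, ∑ v ∈ Finset.Ico 1 (m q),
      (M m q : ℝ) * cyl m A (v • e m q) u) + ((m A : ℝ) - 1) * (M m A * cyl m A 0 u) := by
  rw [fejerMaj, Finset.sum_range_succ]
  simp only [cyl_smul_e_self, Finset.sum_const, Nat.card_Ico]
  rw [_root_.nsmul_eq_mul, Nat.cast_sub (by have := hm A; omega), Nat.cast_one]

theorem M_mul_cyl_le_fejerMaj (hm : ∀ k, 2 ≤ m k) (A : ℕ) (u : VilenkinGroup m) :
    M m A * cyl m A 0 u ≤ fejerMaj m A u := by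
  rw [fejerMaj_eq_add hm]
  have h1 : 0 ≤ ∑ q ∈ Finset.range A, ∑ v ∈ Finset.Ico 1 (m q),
      (M m q : ℝ) * cyl m A (v • e m q) u :=
    Finset.sum_nonneg fun _ _ => Finset.sum_nonneg fun _ _ =>
      mul_nonneg (Nat.cast_nonneg _) (cyl_nonneg _ _ _)
  have h2 : 0 ≤ M m A * cyl m A 0 u := mul_nonneg (Nat.cast_nonneg _) (cyl_nonneg _ _ _)
  have h3 : (2 : ℝ) ≤ m A := by exact_mod_cast hm A
  nlinarith

/-- The induction step for the Fejér bound, arranged so that the constant does not grow. If $u_A =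
0$, the cylinders with $q < A$ persist at level $A+1$ and the central term grows enough to absorb
the rest. If $u_A \ne 0$, the factor vanishes and the summand $q = A$, $v = u_A$ on the right
already equals the remaining term. -/
theorem rFactor_mul_fejerMaj_add_le (hm : ∀ k, 2 ≤ m k) (A : ℕ) (u : VilenkinGroup m) :
    rFactor m A u * fejerMaj m A u + M m A * cyl m A 0 u ≤ m A * fejerMaj m (A + 1) u := by
  have hA : (2 : ℝ) ≤ m A := by exact_mod_cast hm A
  have hc : 0 ≤ M m A * cyl m A 0 u := mul_nonneg (Nat.cast_nonneg _) (cyl_nonneg _ _ _)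
  by_cases hu : u A = 0
  · have h1 : ∑ q ∈ Finset.range A, ∑ v ∈ Finset.Ico 1 (m q),
        (M m q : ℝ) * cyl m A (v • e m q) u ≤ ∑ q ∈ Finset.range (A + 1),
          ∑ v ∈ Finset.Ico 1 (m q), (M m q : ℝ) * cyl m (A + 1) (v • e m q) u := by
      rw [Finset.sum_range_succ]
      refine (le_of_eq (Finset.sum_congr rfl fun q hq => Finset.sum_congr rfl fun v _ => ?_)).trans
        (le_add_of_nonneg_right (Finset.sum_nonneg fun _ _ =>
          mul_nonneg (Nat.cast_nonneg _) (cyl_nonneg _ _ _)))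
      rw [cyl_succ, smul_e_apply_of_ne (Finset.mem_range.1 hq).ne', if_pos hu, mul_one]
    rw [fejerMaj_eq_add hm (A + 1), fejerMaj_eq_add hm A, rFactor, if_pos hu, cyl_succ, M_succ,
      if_pos (by simpa using hu)]
    have hA' : (2 : ℝ) ≤ m (A + 1) := by exact_mod_cast hm (A + 1)
    push_cast
    have h2 : (0 : ℝ) ≤ (m (A + 1) - 2) * (m A * (m A * (M m A * cyl m A 0 u))) :=
      mul_nonneg (by linarith) (by positivity)
    have h3 := mul_le_mul_of_nonneg_left h1 (by linarith : (0 : ℝ) ≤ m A)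
    nlinarith
  · rw [rFactor, if_neg hu, zero_mul, zero_add]
    have := neZero hm A
    have h1 : M m A * cyl m A 0 u ≤ fejerMaj m (A + 1) u := by
      have hv : (u A).val ∈ Finset.Ico 1 (m A) := by
        rw [Finset.mem_Ico]
        exact ⟨Nat.pos_of_ne_zero fun h => hu ((ZMod.val_eq_zero _).1 h), ZMod.val_lt _⟩
      have h2 : M m A * cyl m A 0 u =
          (M m A : ℝ) * cyl m (A + 1) ((u A).val • e m A) u := by
        rw [cyl_succ, cyl_smul_e_self, smul_e_apply_self, ZMod.natCast_zmod_val, if_pos rfl,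
          mul_one]
      rw [h2]
      refine (Finset.single_le_sum (f := fun v : ℕ => (M m A : ℝ) * cyl m (A + 1) (v • e m A) u)
        (fun _ _ => mul_nonneg (Nat.cast_nonneg _) (cyl_nonneg _ _ _)) hv).trans ?_
      exact Finset.single_le_sum (f := fun q : ℕ => ∑ v ∈ Finset.Ico 1 (m q),
        (M m q : ℝ) * cyl m (A + 1) (v • e m q) u) (fun _ _ => Finset.sum_nonneg fun _ _ =>
          mul_nonneg (Nat.cast_nonneg _) (cyl_nonneg _ _ _)) (by simp)
    nlinarith [fejerMaj_nonneg (A + 1) u]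

/-! ### Dirichlet and Fejér kernels by blocks. -/

theorem sum_range_mul_eq {α : Type*} [AddCommMonoid α] (g : ℕ → α) (a b : ℕ) :
    ∑ j ∈ Finset.range (a * b), g j =
      ∑ c ∈ Finset.range a, ∑ i ∈ Finset.range b, g (c * b + i) := by
  induction a with
  | zero => simp
  | succ a ih => rw [add_mul, one_mul, Finset.sum_range_add, ih, Finset.sum_range_succ]

theorem dirichlet_mul_add (hm : ∀ k, 2 ≤ m k) {A i : ℕ} (c : ℕ) (hi : i ≤ M m A)
    (t : VilenkinGroup m) : dirichlet m (c * M m A + i) t =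
      dirichlet m (c * M m A) t + psi m (c * M m A) t * dirichlet m i t := by
  rw [dirichlet, Finset.sum_range_add, dirichlet, dirichlet, Finset.mul_sum]
  congr 1
  exact Finset.sum_congr rfl fun j hj =>
    psi_mul_add hm c ((Finset.mem_range.1 hj).trans_le hi) t

theorem dirichlet_mul_M (hm : ∀ k, 2 ≤ m k) (A c : ℕ) (t : VilenkinGroup m) :
    dirichlet m (c * M m A) t =
      (∑ b ∈ Finset.range c, psi m (b * M m A) t) * dirichlet m (M m A) t := by
  rw [dirichlet, sum_range_mul_eq, Finset.sum_mul]
  refine Finset.sum_congr rfl fun b _ => ?_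
  rw [dirichlet, Finset.mul_sum]
  exact Finset.sum_congr rfl fun j hj => psi_mul_add hm b (Finset.mem_range.1 hj) t

/-- Paley's identity: each new level multiplies by a full character sum, which is $m_A$ or $0$
according to $t_A$. -/
theorem dirichlet_M (hm : ∀ k, 2 ≤ m k) (A : ℕ) (t : VilenkinGroup m) :
    dirichlet m (M m A) t = ((M m A * cyl m A 0 t : ℝ) : ℂ) := by
  induction A with
  | zero => simp [dirichlet, M, psi_zero hm, cyl_zero]
  | succ A ih =>
    rw [M_succ, dirichlet_mul_M hm, ih, cyl_succ,
      Finset.sum_congr rfl fun b hb => psi_mul_M hm (Finset.mem_range.1 hb) t,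
      sum_rademacher_pow hm]
    by_cases h : t A = 0 <;> simp [h]; ring

theorem norm_dirichlet_mul_M_le (hm : ∀ k, 2 ≤ m k) (A c : ℕ) (t : VilenkinGroup m) :
    ‖dirichlet m (c * M m A) t‖ ≤ c * (M m A * cyl m A 0 t) := by
  rw [dirichlet_mul_M hm, norm_mul, dirichlet_M hm, Complex.norm_real, Real.norm_of_nonneg
    (mul_nonneg (Nat.cast_nonneg _) (cyl_nonneg _ _ _))]
  refine mul_le_mul_of_nonneg_right ((norm_sum_le _ _).trans ?_)
    (mul_nonneg (Nat.cast_nonneg _) (cyl_nonneg _ _ _))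
  simp [norm_psi hm]

theorem fejerSum_succ (hm : ∀ k, 2 ≤ m k) (A : ℕ) (u : VilenkinGroup m) :
    fejerSum m (A + 1) u = M m A * ∑ c ∈ Finset.range (m A), dirichlet m (c * M m A) u
      + rFactor m A u * fejerSum m A u := by
  rw [fejerSum, M_succ, sum_range_mul_eq, ← sum_rademacher_pow_eq_rFactor hm, Finset.sum_mul,
    Finset.mul_sum, ← Finset.sum_add_distrib]
  refine Finset.sum_congr rfl fun c hc => ?_
  rw [Finset.sum_congr rfl fun i hi => dirichlet_mul_add hm c (Finset.mem_range.1 hi).le u,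
    Finset.sum_add_distrib, ← Finset.mul_sum, psi_mul_M hm (Finset.mem_range.1 hc), fejerSum]
  simp

/-- One factor $B$ counts the blocks and the other bounds $c$ in $D_{cM_A}$;
`rFactor_mul_fejerMaj_add_le` closes the induction with the same constant. -/
theorem norm_fejerSum_le (hm : ∀ k, 2 ≤ m k) {B : ℕ} (hB : ∀ k, m k ≤ B) (A : ℕ)
    (u : VilenkinGroup m) : ‖fejerSum m A u‖ ≤ (B : ℝ) ^ 2 * (M m A * fejerMaj m A u) := by
  induction A with
  | zero =>
    have : fejerSum m 0 u = 0 := by simp [fejerSum, M, dirichlet]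
    rw [this, norm_zero]
    exact mul_nonneg (by positivity) (mul_nonneg (Nat.cast_nonneg _) (fejerMaj_nonneg _ _))
  | succ A ih =>
    have hc : 0 ≤ M m A * cyl m A 0 u := mul_nonneg (Nat.cast_nonneg _) (cyl_nonneg _ _ _)
    have hmB : (m A : ℝ) ≤ B := by exact_mod_cast hB A
    have h1 : ‖∑ c ∈ Finset.range (m A), dirichlet m (c * M m A) u‖ ≤
        (B : ℝ) ^ 2 * (M m A * cyl m A 0 u) := by
      refine (norm_sum_le_of_le (n := fun _ => (B : ℝ) * (M m A * cyl m A 0 u)) _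
        fun c hc' => (norm_dirichlet_mul_M_le hm A c u).trans ?_).trans ?_
      · refine mul_le_mul_of_nonneg_right ?_ hc
        exact_mod_cast (Finset.mem_range.1 hc').le.trans (hB A)
      · rw [Finset.sum_const, Finset.card_range, nsmul_eq_mul, sq, mul_assoc]
        exact mul_le_mul_of_nonneg_right hmB (by positivity)
    rw [fejerSum_succ hm]
    refine (norm_add_le _ _).trans ?_
    rw [norm_mul, norm_mul, Complex.norm_natCast, Complex.norm_real,
      Real.norm_of_nonneg (rFactor_nonneg _ _)]
    have h2 := mul_le_mul_of_nonneg_left h1 (Nat.cast_nonneg (α := ℝ) (M m A))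
    have h3 := mul_le_mul_of_nonneg_left ih (rFactor_nonneg A u)
    have h4 := mul_le_mul_of_nonneg_left (rFactor_mul_fejerMaj_add_le hm A u)
      (by positivity : (0 : ℝ) ≤ (B : ℝ) ^ 2 * M m A)
    rw [M_succ]
    push_cast
    nlinarith

/-! ### Marcinkiewicz kernels of order $M_A$. -/

theorem sum_block (hm : ∀ k, 2 ≤ m k) (A c : ℕ) (t u : VilenkinGroup m) :
    ∑ i ∈ Finset.range (M m A),
      dirichlet m (c * M m A + i) t * dirichlet m (c * M m A + i) u =
    (M m A * (dirichlet m (c * M m A) t * dirichlet m (c * M m A) u)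
      + dirichlet m (c * M m A) t * (psi m (c * M m A) u * fejerSum m A u)
      + dirichlet m (c * M m A) u * (psi m (c * M m A) t * fejerSum m A t))
      + psi m (c * M m A) (t + u) * marcSum m (M m A) t u := by
  have h : ∀ i ∈ Finset.range (M m A),
      dirichlet m (c * M m A + i) t * dirichlet m (c * M m A + i) u =
      dirichlet m (c * M m A) t * dirichlet m (c * M m A) u
      + dirichlet m (c * M m A) t * psi m (c * M m A) u * dirichlet m i u
      + dirichlet m (c * M m A) u * psi m (c * M m A) t * dirichlet m i t
      + psi m (c * M m A) (t + u) * (dirichlet m i t * dirichlet m i u) := by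
    intro i hi
    rw [dirichlet_mul_add hm c (Finset.mem_range.1 hi).le,
      dirichlet_mul_add hm c (Finset.mem_range.1 hi).le, psi_add hm]
    ring
  rw [Finset.sum_congr rfl h, marcSum, fejerSum, fejerSum]
  simp only [Finset.sum_add_distrib, Finset.mul_sum, Finset.sum_const, Finset.card_range,
    nsmul_eq_mul, mul_assoc]

/-- The bounds $a, b$ stay free because two choices are needed: a single cylinder when $c < m_A$,
and a tail of cylinders for general $c$. -/
theorem norm_block_main_le (hm : ∀ k, 2 ≤ m k) {B : ℕ} (hB : ∀ k, m k ≤ B) (A c : ℕ)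
    (t u : VilenkinGroup m) {a b : ℝ} (ha : ‖dirichlet m (c * M m A) t‖ ≤ a)
    (hb : ‖dirichlet m (c * M m A) u‖ ≤ b) :
    ‖M m A * (dirichlet m (c * M m A) t * dirichlet m (c * M m A) u)
      + dirichlet m (c * M m A) t * (psi m (c * M m A) u * fejerSum m A u)
      + dirichlet m (c * M m A) u * (psi m (c * M m A) t * fejerSum m A t)‖ ≤
    M m A * (a * b) + (B : ℝ) ^ 2 * (a * (M m A * fejerMaj m A u))
      + (B : ℝ) ^ 2 * (b * (M m A * fejerMaj m A t)) := by
  have ha0 := (norm_nonneg _).trans ha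
  have hb0 := (norm_nonneg _).trans hb
  refine norm_add₃_le.trans ?_
  simp only [norm_mul, Complex.norm_natCast, norm_psi hm, one_mul]
  have h1 := norm_fejerSum_le hm hB A t
  have h2 := norm_fejerSum_le hm hB A u
  have h3 : ‖dirichlet m (c * M m A) t‖ * ‖fejerSum m A u‖ ≤
      a * ((B : ℝ) ^ 2 * (M m A * fejerMaj m A u)) := by gcongr
  have h4 : ‖dirichlet m (c * M m A) u‖ * ‖fejerSum m A t‖ ≤
      b * ((B : ℝ) ^ 2 * (M m A * fejerMaj m A t)) := by gcongr
  have h5 : (M m A : ℝ) * (‖dirichlet m (c * M m A) t‖ * ‖dirichlet m (c * M m A) u‖) ≤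
      M m A * (a * b) := by gcongr
  linarith

/-- The same recursion as in `marcSum_M_succ`, with the block terms replaced by a majorant. -/
theorem diagKernel_succ (j : ℕ) (t u : VilenkinGroup m) :
    diagKernel m (j + 1) t u = rFactor m j (t + u) * diagKernel m j t u +
      (M m j : ℝ) ^ 2 * (cyl m j 0 t * fejerMaj m j u) := by
  rw [diagKernel, Finset.sum_range_succ, diagKernel, Finset.mul_sum]
  congr 1
  · refine Finset.sum_congr rfl fun k hk => ?_
    rw [Finset.prod_Ico_succ_top (Finset.mem_range.1 hk)]
    ring
  · simp

theorem diagKernel_nonneg (j : ℕ) (t u : VilenkinGroup m) : 0 ≤ diagKernel m j t u :=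
  Finset.sum_nonneg fun _ _ => mul_nonneg (mul_nonneg (by positivity)
    (mul_nonneg (cyl_nonneg _ _ _) (fejerMaj_nonneg _ _)))
    (Finset.prod_nonneg fun _ _ => rFactor_nonneg _ _)

theorem marcSum_M_succ (hm : ∀ k, 2 ≤ m k) (A : ℕ) (t u : VilenkinGroup m) :
    marcSum m (M m (A + 1)) t u = (∑ c ∈ Finset.range (m A),
      (M m A * (dirichlet m (c * M m A) t * dirichlet m (c * M m A) u)
      + dirichlet m (c * M m A) t * (psi m (c * M m A) u * fejerSum m A u)
      + dirichlet m (c * M m A) u * (psi m (c * M m A) t * fejerSum m A t)))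
      + rFactor m A (t + u) * marcSum m (M m A) t u := by
  rw [marcSum, M_succ, sum_range_mul_eq, Finset.sum_congr rfl fun c _ => sum_block hm A c t u,
    Finset.sum_add_distrib, ← Finset.sum_mul, ← sum_rademacher_pow_eq_rFactor hm,
    Finset.sum_congr rfl fun c hc => psi_mul_M hm (Finset.mem_range.1 hc) (t + u)]

theorem norm_marcSum_M_le (hm : ∀ k, 2 ≤ m k) {B : ℕ} (hB : ∀ k, m k ≤ B) (A : ℕ)
    (t u : VilenkinGroup m) : ‖marcSum m (M m A) t u‖ ≤
      2 * (B : ℝ) ^ 4 * (diagKernel m A t u + diagKernel m A u t) := by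
  induction A with
  | zero => simp [marcSum, M, dirichlet, diagKernel]
  | succ A ih =>
    have hB1 : (1 : ℝ) ≤ B := by exact_mod_cast (by omega : 1 ≤ 2).trans ((hm 0).trans (hB 0))
    have ht : 0 ≤ M m A * cyl m A 0 t := mul_nonneg (Nat.cast_nonneg _) (cyl_nonneg _ _ _)
    have hu : 0 ≤ M m A * cyl m A 0 u := mul_nonneg (Nat.cast_nonneg _) (cyl_nonneg _ _ _)
    have hGt := fejerMaj_nonneg A t
    have hGu := fejerMaj_nonneg A u
    set x := M m A * cyl m A 0 t
    set y := M m A * cyl m A 0 u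
    have hy : y ≤ fejerMaj m A u := M_mul_cyl_le_fejerMaj hm A u
    have h1 : ∀ c ∈ Finset.range (m A),
        ‖M m A * (dirichlet m (c * M m A) t * dirichlet m (c * M m A) u)
        + dirichlet m (c * M m A) t * (psi m (c * M m A) u * fejerSum m A u)
        + dirichlet m (c * M m A) u * (psi m (c * M m A) t * fejerSum m A t)‖ ≤
        M m A * ((B * x) * (B * y)) + (B : ℝ) ^ 2 * ((B * x) * (M m A * fejerMaj m A u))
        + (B : ℝ) ^ 2 * ((B * y) * (M m A * fejerMaj m A t)) := by
      intro c hc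
      have hcB : (c : ℝ) ≤ B := by exact_mod_cast (Finset.mem_range.1 hc).le.trans (hB A)
      exact norm_block_main_le hm hB A c t u
        ((norm_dirichlet_mul_M_le hm A c t).trans (mul_le_mul_of_nonneg_right hcB ht))
        ((norm_dirichlet_mul_M_le hm A c u).trans (mul_le_mul_of_nonneg_right hcB hu))
    have hmB : (m A : ℝ) ≤ B := by exact_mod_cast hB A
    have h2 := norm_sum_le_of_le _ h1
    rw [Finset.sum_const, Finset.card_range, nsmul_eq_mul] at h2
    -- The product term is absorbed into the term with `fejerMaj m A u` through `hy`, which accounts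
    -- for the factor $2$; the fourth power of $B$ includes one for the number of blocks.
    have h3 : (m A : ℝ) * (M m A * ((B * x) * (B * y))
        + (B : ℝ) ^ 2 * ((B * x) * (M m A * fejerMaj m A u))
        + (B : ℝ) ^ 2 * ((B * y) * (M m A * fejerMaj m A t))) ≤
        2 * (B : ℝ) ^ 4 * (M m A * (x * fejerMaj m A u) + M m A * (y * fejerMaj m A t)) := by
      have e1 : (M m A : ℝ) * ((B * x) * (B * y)) ≤
          (B : ℝ) ^ 3 * (M m A * (x * fejerMaj m A u)) := by
        have : (B : ℝ) ^ 2 * (M m A * (x * y)) ≤ (B : ℝ) ^ 3 * (M m A * (x * fejerMaj m A u)) := by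
          gcongr
          · norm_num
        linarith
      have e2 : 0 ≤ (B : ℝ) ^ 3 * (M m A * (y * fejerMaj m A t)) := by positivity
      refine (mul_le_mul_of_nonneg_right hmB (by positivity)).trans ?_
      have e3 := mul_le_mul_of_nonneg_left e1 (by positivity : (0 : ℝ) ≤ B)
      have e4 := mul_nonneg (by positivity : (0 : ℝ) ≤ B) e2
      nlinarith
    rw [marcSum_M_succ hm, diagKernel_succ, diagKernel_succ, add_comm u t]
    refine (norm_add_le _ _).trans ?_
    rw [norm_mul, Complex.norm_real, Real.norm_of_nonneg (rFactor_nonneg _ _)]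
    have h4 := mul_le_mul_of_nonneg_left ih (rFactor_nonneg A (t + u))
    have h5 := h2.trans h3
    simp only [x, y] at h5 ⊢
    linarith

end Kernels

end Vilenkin

namespace Vilenkin

/-! ### The kernel majorant for arbitrary $n$. -/

noncomputable section Majorant

variable {m : ℕ → ℕ}

/-- The nonnegative kernel of the functional `W_j`. -/
def wKernel (m : ℕ → ℕ) (j : ℕ) (t u : VilenkinGroup m) : ℝ :=
  (M m j : ℝ)⁻¹ * diagKernel m j t u + (M m j : ℝ)⁻¹ * diagKernel m j u t
    + sideKernel m j t u + sideKernel m j u t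

theorem div_mod_decomp (A c : ℕ) : c * M m A = c / m A * M m (A + 1) + c % m A * M m A := by
  rw [M_succ, ← mul_assoc, ← add_mul, mul_comm (c / m A), Nat.div_add_mod]

/-- Peel off the lowest digit of $c$: it costs one cylinder term at level $A$ and leaves a multiple
of $M_{A+1}$. At level $N$ the constraint forces $c = 0$. -/
theorem norm_dirichlet_le_tail (hm : ∀ k, 2 ≤ m k) {B : ℕ} (hB : ∀ k, m k ≤ B) {N d A c : ℕ}
    (hd : A + d = N) (hc : c * M m A < M m N) (t : VilenkinGroup m) :
    ‖dirichlet m (c * M m A) t‖ ≤ B * ∑ l ∈ Finset.Ico A N, M m l * cyl m l 0 t := by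
  induction d generalizing A c with
  | zero =>
    obtain rfl : A = N := by omega
    have hc0 : c = 0 := by
      by_contra h
      exact absurd hc (not_lt.2 (Nat.le_mul_of_pos_left _ (Nat.pos_of_ne_zero h)))
    simp [hc0, dirichlet]
  | succ d ih =>
    have hmod : c % m A < m A := Nat.mod_lt _ (by have := hm A; omega)
    have h1 := div_mod_decomp (m := m) A c
    have h2 := ih (A := A + 1) (c := c / m A) (by omega) (by omega)
    have h3 : c % m A * M m A ≤ M m (A + 1) := by
      rw [M_succ]; exact Nat.mul_le_mul_right _ hmod.le
    rw [h1, dirichlet_mul_add hm _ h3, Finset.sum_eq_sum_Ico_succ_bot (by omega : A < N)]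
    refine (norm_add_le _ _).trans ?_
    rw [norm_mul, norm_psi hm, one_mul, mul_add, add_comm]
    refine add_le_add ((norm_dirichlet_mul_M_le hm A _ t).trans ?_) h2
    exact mul_le_mul_of_nonneg_right (by exact_mod_cast hmod.le.trans (hB A))
      (mul_nonneg (Nat.cast_nonneg _) (cyl_nonneg _ _ _))

/-- The same digit peeling, now applied to the range of summation: level $A$ contributes `c % m A`,
at most $B$, blocks of length $M_A$. -/
theorem norm_marcSum_le_sum_blocks (hm : ∀ k, 2 ≤ m k) {b : ℕ → ℝ} {B : ℕ} (hB : ∀ k, m k ≤ B)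
    {N : ℕ} {t u : VilenkinGroup m}
    (hb : ∀ A < N, ∀ c, c * M m A < M m N → ‖∑ i ∈ Finset.range (M m A),
      dirichlet m (c * M m A + i) t * dirichlet m (c * M m A + i) u‖ ≤ b A)
    {d A c : ℕ} (hd : A + d = N) (hc : c * M m A < M m N) :
    ‖marcSum m (c * M m A) t u‖ ≤ B * ∑ l ∈ Finset.Ico A N, b l := by
  induction d generalizing A c with
  | zero =>
    obtain rfl : A = N := by omega
    have hc0 : c = 0 := by
      by_contra h
      exact absurd hc (not_lt.2 (Nat.le_mul_of_pos_left _ (Nat.pos_of_ne_zero h)))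
    simp [hc0, marcSum]
  | succ d ih =>
    have hmod : c % m A < m A := Nat.mod_lt _ (by have := hm A; omega)
    have h1 := div_mod_decomp (m := m) A c
    have h2 := ih (A := A + 1) (c := c / m A) (by omega) (by omega)
    have hb0 : 0 ≤ b A := (norm_nonneg _).trans (hb A (by omega) c hc)
    have h3 : marcSum m (c * M m A) t u = marcSum m (c / m A * M m (A + 1)) t u +
        ∑ a ∈ Finset.range (c % m A), ∑ i ∈ Finset.range (M m A),
          dirichlet m ((c / m A * m A + a) * M m A + i) t *
          dirichlet m ((c / m A * m A + a) * M m A + i) u := by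
      rw [h1, marcSum, Finset.sum_range_add, sum_range_mul_eq _ (c % m A), marcSum]
      simp only [M_succ, add_mul, mul_assoc, add_assoc]
    rw [h3, Finset.sum_eq_sum_Ico_succ_bot (by omega : A < N), mul_add, add_comm]
    refine (norm_add_le _ _).trans (add_le_add ((norm_sum_le_of_le (n := fun _ => b A) _
      fun a ha => hb A (by omega) _ (lt_of_le_of_lt ?_ hc)).trans ?_) h2)
    · have : c / m A * m A + a ≤ c := by
        have := Nat.div_add_mod c (m A)
        have := Finset.mem_range.1 ha
        rw [mul_comm]; omega
      exact Nat.mul_le_mul_right _ this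
    · rw [Finset.sum_const, Finset.card_range, _root_.nsmul_eq_mul]
      exact mul_le_mul_of_nonneg_right (by exact_mod_cast hmod.le.trans (hB A)) hb0

theorem sum_mul_sum_Ico (w b : ℕ → ℝ) (n : ℕ) :
    ∑ A ∈ Finset.range n, w A * ∑ l ∈ Finset.Ico A n, b l =
      ∑ l ∈ Finset.range n, b l * ∑ A ∈ Finset.range (l + 1), w A := by
  induction n with
  | zero => simp
  | succ n ih =>
    rw [Finset.sum_range_succ _ n, Finset.sum_range_succ _ n, ← ih]
    have : ∀ A ∈ Finset.range n, w A * ∑ l ∈ Finset.Ico A (n + 1), b l =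
        w A * ∑ l ∈ Finset.Ico A n, b l + b n * w A := fun A hA => by
      rw [Finset.sum_Ico_succ_top (Finset.mem_range.1 hA).le]; ring
    rw [Finset.sum_congr rfl this, Finset.sum_add_distrib, ← Finset.mul_sum,
      Finset.sum_range_succ _ n]
    simp
    ring

/-- Sum over $A \le \min(l,l')$ and split by which of $l, l'$ is larger. The diagonal is counted
twice, hence an inequality. -/
theorem sum_mul_sum_Ico_mul_sum_Ico_le {w a b : ℕ → ℝ} (hw : ∀ k, 0 ≤ w k) (ha : ∀ k, 0 ≤ a k)
    (hb : ∀ k, 0 ≤ b k) (n : ℕ) :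
    ∑ A ∈ Finset.range n, w A * ((∑ l ∈ Finset.Ico A n, a l) * ∑ l ∈ Finset.Ico A n, b l) ≤
      (∑ l ∈ Finset.range n, a l * ∑ i ∈ Finset.range (l + 1), b i * ∑ A ∈ Finset.range (i + 1), w A)
      + ∑ l ∈ Finset.range n,
        b l * ∑ i ∈ Finset.range (l + 1), a i * ∑ A ∈ Finset.range (i + 1), w A := by
  induction n with
  | zero => simp
  | succ n ih =>
    have h : ∀ A ∈ Finset.range (n + 1),
        w A * ((∑ l ∈ Finset.Ico A (n + 1), a l) * ∑ l ∈ Finset.Ico A (n + 1), b l) ≤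
        w A * ((∑ l ∈ Finset.Ico A n, a l) * ∑ l ∈ Finset.Ico A n, b l)
        + (a n * (w A * ∑ l ∈ Finset.Ico A (n + 1), b l)
          + b n * (w A * ∑ l ∈ Finset.Ico A (n + 1), a l)) := fun A hA => by
      have hA' : A ≤ n := by have := Finset.mem_range.1 hA; omega
      rw [Finset.sum_Ico_succ_top hA', Finset.sum_Ico_succ_top hA']
      nlinarith [mul_nonneg (hw A) (mul_nonneg (ha n) (hb n))]
    refine (Finset.sum_le_sum h).trans ?_
    have h0 : ∑ A ∈ Finset.range (n + 1),
        w A * ((∑ l ∈ Finset.Ico A n, a l) * ∑ l ∈ Finset.Ico A n, b l) =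
        ∑ A ∈ Finset.range n, w A * ((∑ l ∈ Finset.Ico A n, a l) * ∑ l ∈ Finset.Ico A n, b l) := by
      rw [Finset.sum_range_succ _ n]; simp
    have hs : ∀ c d : ℕ → ℝ, ∑ l ∈ Finset.range (n + 1),
        c l * ∑ i ∈ Finset.range (l + 1), d i * ∑ A ∈ Finset.range (i + 1), w A =
        ∑ l ∈ Finset.range n,
          c l * ∑ i ∈ Finset.range (l + 1), d i * ∑ A ∈ Finset.range (i + 1), w A
        + c n * ∑ i ∈ Finset.range (n + 1), d i * ∑ A ∈ Finset.range (i + 1), w A :=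
      fun _ _ => Finset.sum_range_succ _ _
    rw [Finset.sum_add_distrib, Finset.sum_add_distrib, ← Finset.mul_sum, ← Finset.mul_sum,
      sum_mul_sum_Ico, sum_mul_sum_Ico, h0, hs a b, hs b a]
    linarith

/-- After reordering, the innermost sum $\sum_{A\le i} M_A$ is at most $2M_i$, and $M_i 1_{I_i}$ is
dominated by the Fejér majorant; what remains is `sideKernel`. -/
theorem sum_M_mul_tail_mul_tail_le (hm : ∀ k, 2 ≤ m k) (N : ℕ) (t u : VilenkinGroup m) :
    ∑ A ∈ Finset.range N, (M m A : ℝ) * ((∑ l ∈ Finset.Ico A N, M m l * cyl m l 0 t) *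
      ∑ l ∈ Finset.Ico A N, M m l * cyl m l 0 u) ≤
    2 * ∑ A ∈ Finset.range N, (M m A : ℝ) * (sideKernel m A t u + sideKernel m A u t) := by
  have hc : ∀ (v : VilenkinGroup m) l, 0 ≤ (M m l : ℝ) * cyl m l 0 v := fun v l =>
    mul_nonneg (Nat.cast_nonneg _) (cyl_nonneg _ _ _)
  refine (sum_mul_sum_Ico_mul_sum_Ico_le (fun k => Nat.cast_nonneg (M m k)) (hc t) (hc u)
    N).trans ?_
  have key : ∀ v w : VilenkinGroup m, ∑ l ∈ Finset.range N, M m l * cyl m l 0 v *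
      ∑ i ∈ Finset.range (l + 1), M m i * cyl m i 0 w * ∑ A ∈ Finset.range (i + 1), (M m A : ℝ) ≤
      ∑ l ∈ Finset.range N, 2 * (M m l * sideKernel m l v w) := fun v w => by
    refine Finset.sum_le_sum fun l _ => ?_
    have h : ∑ i ∈ Finset.range (l + 1), M m i * cyl m i 0 w *
        ∑ A ∈ Finset.range (i + 1), (M m A : ℝ) ≤
        ∑ i ∈ Finset.range (l + 1), 2 * (M m i * fejerMaj m i w) := by
      refine Finset.sum_le_sum fun i _ => ?_
      have h1 : ∑ A ∈ Finset.range (i + 1), (M m A : ℝ) ≤ 2 * M m i := by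
        exact_mod_cast sum_M_le hm i
      have h2 := mul_le_mul (M_mul_cyl_le_fejerMaj hm i w) h1 (by positivity)
        (fejerMaj_nonneg i w)
      linarith
    have h3 := mul_le_mul_of_nonneg_left h (hc v l)
    rw [← Finset.mul_sum] at h3
    rw [sideKernel]
    linarith
  refine (add_le_add (key t u) (key u t)).trans (le_of_eq ?_)
  rw [← Finset.sum_add_distrib, Finset.mul_sum]
  exact Finset.sum_congr rfl fun _ _ => by ring

theorem sum_tail_mul_fejerMaj (N : ℕ) (t u : VilenkinGroup m) :
    ∑ A ∈ Finset.range N, (∑ l ∈ Finset.Ico A N, M m l * cyl m l 0 t) *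
      (M m A * fejerMaj m A u) =
    ∑ A ∈ Finset.range N, (M m A : ℝ) * sideKernel m A t u := by
  simp only [mul_comm (Finset.sum _ _) (_ * fejerMaj m _ u)]
  rw [sum_mul_sum_Ico]
  exact Finset.sum_congr rfl fun _ _ => by rw [sideKernel, mul_assoc]

theorem norm_marcSum_le (hm : ∀ k, 2 ≤ m k) {B : ℕ} (hB : ∀ k, m k ≤ B) {n N : ℕ}
    (hn : n < M m N) (t u : VilenkinGroup m) : ‖marcSum m n t u‖ ≤
      5 * (B : ℝ) ^ 5 * ∑ A ∈ Finset.range N, (M m A : ℝ) * wKernel m A t u := by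
  have hB1 : (1 : ℝ) ≤ B := by exact_mod_cast (by omega : 1 ≤ 2).trans ((hm 0).trans (hB 0))
  set E : VilenkinGroup m → ℕ → ℝ := fun v A => ∑ l ∈ Finset.Ico A N, M m l * cyl m l 0 v
  have hb : ∀ A < N, ∀ c, c * M m A < M m N → ‖∑ i ∈ Finset.range (M m A),
      dirichlet m (c * M m A + i) t * dirichlet m (c * M m A + i) u‖ ≤
      (M m A * ((B * E t A) * (B * E u A)) + (B : ℝ) ^ 2 * ((B * E t A) * (M m A * fejerMaj m A u))
      + (B : ℝ) ^ 2 * ((B * E u A) * (M m A * fejerMaj m A t)))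
      + 2 * (B : ℝ) ^ 4 * (diagKernel m A t u + diagKernel m A u t) := fun A hA c hc => by
    rw [sum_block hm]
    refine (norm_add_le _ _).trans (add_le_add (norm_block_main_le hm hB A c t u
      (norm_dirichlet_le_tail hm hB (d := N - A) (by omega) hc t)
      (norm_dirichlet_le_tail hm hB (d := N - A) (by omega) hc u)) ?_)
    rw [norm_mul, norm_psi hm, one_mul]
    exact norm_marcSum_M_le hm hB A t u
  have h1 := norm_marcSum_le_sum_blocks hm hB hb (d := N) (A := 0) (c := n) (by omega)
    (by simpa [M] using hn)
  rw [show n * M m 0 = n by simp [M]] at h1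
  refine h1.trans ?_
  rw [Nat.Ico_zero_eq_range, mul_comm 5, pow_succ' _ 4, mul_assoc (B : ℝ), mul_assoc (B : ℝ)]
  -- One factor $B$ comes from the number of blocks per level. Below, the side part picks up $2+1$
  -- and the diagonal part $2$, each times $B^4$; $5$ covers both.
  refine mul_le_mul_of_nonneg_left ?_ (by linarith)
  have e1 : ∑ A ∈ Finset.range N,
      ((M m A * ((B * E t A) * (B * E u A)) + (B : ℝ) ^ 2 * ((B * E t A) * (M m A * fejerMaj m A u))
      + (B : ℝ) ^ 2 * ((B * E u A) * (M m A * fejerMaj m A t)))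
      + 2 * (B : ℝ) ^ 4 * (diagKernel m A t u + diagKernel m A u t)) =
      (B : ℝ) ^ 2 * (∑ A ∈ Finset.range N, M m A * (E t A * E u A))
      + (B : ℝ) ^ 3 * (∑ A ∈ Finset.range N, E t A * (M m A * fejerMaj m A u))
      + (B : ℝ) ^ 3 * (∑ A ∈ Finset.range N, E u A * (M m A * fejerMaj m A t))
      + 2 * (B : ℝ) ^ 4 * (∑ A ∈ Finset.range N, (diagKernel m A t u + diagKernel m A u t)) := by
    simp only [Finset.mul_sum, ← Finset.sum_add_distrib]
    exact Finset.sum_congr rfl fun _ _ => by ring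
  have e2 : ∑ A ∈ Finset.range N, (M m A : ℝ) * wKernel m A t u =
      ∑ A ∈ Finset.range N, (diagKernel m A t u + diagKernel m A u t)
      + ∑ A ∈ Finset.range N, (M m A : ℝ) * (sideKernel m A t u + sideKernel m A u t) := by
    rw [← Finset.sum_add_distrib]
    refine Finset.sum_congr rfl fun A _ => ?_
    have : (M m A : ℝ) ≠ 0 := by exact_mod_cast (M_pos hm A).ne'
    rw [wKernel]
    field_simp
    ring
  have e3 : ∑ A ∈ Finset.range N, (M m A : ℝ) * (sideKernel m A t u + sideKernel m A u t) =
      ∑ A ∈ Finset.range N, (M m A : ℝ) * sideKernel m A t u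
      + ∑ A ∈ Finset.range N, (M m A : ℝ) * sideKernel m A u t := by
    simp only [mul_add, Finset.sum_add_distrib]
  have h2 := sum_M_mul_tail_mul_tail_le hm N t u
  rw [e1, e2, sum_tail_mul_fejerMaj, sum_tail_mul_fejerMaj]
  set S := ∑ A ∈ Finset.range N, (M m A : ℝ) * (sideKernel m A t u + sideKernel m A u t)
  set X := ∑ A ∈ Finset.range N, (diagKernel m A t u + diagKernel m A u t)
  have hS : 0 ≤ S := Finset.sum_nonneg fun _ _ => mul_nonneg (Nat.cast_nonneg _)
    (add_nonneg (sideKernel_nonneg _ _ _) (sideKernel_nonneg _ _ _))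
  have hX : 0 ≤ X := Finset.sum_nonneg fun _ _ =>
    add_nonneg (diagKernel_nonneg _ _ _) (diagKernel_nonneg _ _ _)
  have h3 : (B : ℝ) ^ 2 ≤ (B : ℝ) ^ 4 := pow_le_pow_right₀ hB1 (by norm_num)
  have h4 : (B : ℝ) ^ 3 ≤ (B : ℝ) ^ 4 := pow_le_pow_right₀ hB1 (by norm_num)
  have h5 := mul_le_mul h3 h2 (Finset.sum_nonneg fun A _ => mul_nonneg (Nat.cast_nonneg _)
    (mul_nonneg (Finset.sum_nonneg fun _ _ => mul_nonneg (Nat.cast_nonneg _) (cyl_nonneg _ _ _))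
    (Finset.sum_nonneg fun _ _ => mul_nonneg (Nat.cast_nonneg _) (cyl_nonneg _ _ _))))
    (by positivity)
  have h6 := mul_le_mul_of_nonneg_right h4 hS
  have h7 : 0 ≤ (B : ℝ) ^ 4 * S := by positivity
  have h8 : 0 ≤ (B : ℝ) ^ 4 * X := by positivity
  linarith [congrArg (fun z => (B : ℝ) ^ 3 * z) e3]

end Majorant

end Vilenkin

namespace Vilenkin

/-! ### Haar integration and the integral form of the means. -/

noncomputable section Integration

variable {m : ℕ → ℕ}

/-- Bounded measurable functions. -/
def BddMeasurable {α 𝕜 : Type*} [MeasurableSpace α] [RCLike 𝕜] (g : α → 𝕜) : Prop :=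
  Measurable g ∧ ∃ C, ∀ p, ‖g p‖ ≤ C

section BddMeasurable

variable {α β 𝕜 : Type*} [MeasurableSpace α] [MeasurableSpace β] [RCLike 𝕜]

theorem BddMeasurable.const (c : 𝕜) : BddMeasurable fun _ : α => c :=
  ⟨measurable_const, ‖c‖, fun _ => le_rfl⟩

theorem BddMeasurable.add {f g : α → 𝕜} (hf : BddMeasurable f) (hg : BddMeasurable g) :
    BddMeasurable fun p => f p + g p := by
  obtain ⟨hf, C, hC⟩ := hf
  obtain ⟨hg, D, hD⟩ := hg
  exact ⟨hf.add hg, C + D, fun p => (norm_add_le _ _).trans (add_le_add (hC p) (hD p))⟩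

theorem BddMeasurable.mul {f g : α → 𝕜} (hf : BddMeasurable f) (hg : BddMeasurable g) :
    BddMeasurable fun p => f p * g p := by
  obtain ⟨hf, C, hC⟩ := hf
  obtain ⟨hg, D, hD⟩ := hg
  exact ⟨hf.mul hg, C * D, fun p => by
    rw [norm_mul]
    exact mul_le_mul (hC p) (hD p) (norm_nonneg _) ((norm_nonneg _).trans (hC p))⟩

theorem BddMeasurable.sum {ι : Type*} {s : Finset ι} {f : ι → α → 𝕜}
    (hf : ∀ i ∈ s, BddMeasurable (f i)) : BddMeasurable fun p => ∑ i ∈ s, f i p := by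
  classical
  induction s using Finset.induction_on with
  | empty => simpa using BddMeasurable.const (0 : 𝕜)
  | insert i s hi ih =>
    simp only [Finset.sum_insert hi]
    exact (hf i (by simp)).add (ih fun j hj => hf j (by simp [hj]))

theorem BddMeasurable.prod {ι : Type*} {s : Finset ι} {f : ι → α → 𝕜}
    (hf : ∀ i ∈ s, BddMeasurable (f i)) : BddMeasurable fun p => ∏ i ∈ s, f i p := by
  classical
  induction s using Finset.induction_on with
  | empty => simpa using BddMeasurable.const (1 : 𝕜)
  | insert i s hi ih =>
    simp only [Finset.prod_insert hi]
    exact (hf i (by simp)).mul (ih fun j hj => hf j (by simp [hj]))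

theorem BddMeasurable.comp {g : β → 𝕜} (hg : BddMeasurable g) {φ : α → β} (hφ : Measurable φ) :
    BddMeasurable fun p => g (φ p) :=
  ⟨hg.1.comp hφ, hg.2.imp fun _ hC p => hC (φ p)⟩

theorem BddMeasurable.integrable {μ : Measure α} [IsFiniteMeasure μ] {g : α → 𝕜}
    (hg : BddMeasurable g) : Integrable g μ := by
  obtain ⟨hg, C, hC⟩ := hg
  exact Integrable.of_bound hg.aestronglyMeasurable C (ae_of_all _ hC)

theorem BddMeasurable.integrable_mul {μ : Measure α} {f g : α → 𝕜}
    (hg : BddMeasurable g) (hf : Integrable f μ) : Integrable (fun p => f p * g p) μ := by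
  obtain ⟨hg, C, hC⟩ := hg
  exact hf.mul_bdd hg.aestronglyMeasurable (ae_of_all _ hC)

end BddMeasurable

theorem isProbabilityMeasure_factor (hm : ∀ k, 2 ≤ m k) (k : ℕ) :
    IsProbabilityMeasure ((m k : ENNReal)⁻¹ • (Measure.count : Measure (ZMod (m k)))) := by
  have := neZero hm k
  constructor
  rw [Measure.smul_apply, Measure.count_univ, ENat.card_eq_coe_natCard, Nat.card_zmod,
    smul_eq_mul]
  exact ENNReal.inv_mul_cancel (by simpa using NeZero.ne (m k)) (by simp)

theorem isProbabilityMeasure_haar (hm : ∀ k, 2 ≤ m k) : IsProbabilityMeasure (haar m) := by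
  have := isProbabilityMeasure_factor hm
  rw [haar]
  infer_instance

/-- Each $a \mapsto x_k - a$ is an involution of a finite group, so it preserves counting measure;
the product measure inherits this. -/
theorem measurePreserving_sub_left (hm : ∀ k, 2 ≤ m k) (x : VilenkinGroup m) :
    MeasurePreserving (fun t => x - t) (haar m) (haar m) := by
  have := isProbabilityMeasure_factor hm
  have hmeas : ∀ k, Measurable fun a : ZMod (m k) => x k - a := fun k => measurable_from_top
  refine ⟨measurable_pi_lambda _ fun k => (hmeas k).comp (measurable_pi_apply k), ?_⟩
  have h := Measure.infinitePi_map_pi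
    (fun k => ((m k : ENNReal)⁻¹ • (Measure.count : Measure (ZMod (m k))))) hmeas
  refine h.trans ?_
  rw [haar]
  congr 1
  ext k s hs
  have hinv : Function.Involutive fun a : ZMod (m k) => x k - a := fun a => sub_sub_cancel _ _
  rw [Measure.map_apply (hmeas k) hs, Measure.smul_apply, Measure.smul_apply,
    ← hinv.image_eq_preimage_symm, Measure.count_injective_image hinv.injective]

theorem measurePreserving_sub_left₂ (hm : ∀ k, 2 ≤ m k) (x y : VilenkinGroup m) :
    MeasurePreserving (fun p : VilenkinGroup m × VilenkinGroup m => (x - p.1, y - p.2))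
      (haar₂ m) (haar₂ m) := by
  have := isProbabilityMeasure_haar hm
  exact (measurePreserving_sub_left hm x).prod (measurePreserving_sub_left hm y)

theorem integral_comp_of_measurePreserving {α β E : Type*} [MeasurableSpace α] [MeasurableSpace β]
    [NormedAddCommGroup E] [NormedSpace ℝ E] {μ : Measure α} {ν : Measure β} {φ : α → β}
    (hφ : MeasurePreserving φ μ ν) {g : β → E} (hg : AEStronglyMeasurable g ν) :
    ∫ p, g (φ p) ∂μ = ∫ p, g p ∂ν := by
  rw [← hφ.map_eq, integral_map hφ.aemeasurable (by rwa [hφ.map_eq])]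

theorem measurable_of_coord {E : Type*} [MeasurableSpace E] (k : ℕ) (g : ZMod (m k) → E) :
    Measurable fun x : VilenkinGroup m => g (x k) :=
  (measurable_from_top (f := g)).comp (measurable_pi_apply k)

theorem bddMeasurable_psi (hm : ∀ k, 2 ≤ m k) (n : ℕ) : BddMeasurable (psi m n) := by
  refine ⟨?_, 1, fun x => (norm_psi hm n x).le⟩
  have h : psi m n = fun x => ∏ k ∈ Finset.range n, rademacher m k x ^ digit m n k :=
    funext fun x => psi_eq_prod hm (lt_M hm n) x
  rw [h]
  refine Finset.measurable_prod _ fun k _ => Measurable.pow_const ?_ _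
  exact measurable_of_coord k
    fun a => Complex.exp (2 * Real.pi * Complex.I * (a.val : ℂ) / (m k : ℂ))

theorem bddMeasurable_dirichlet (hm : ∀ k, 2 ≤ m k) (n : ℕ) : BddMeasurable (dirichlet m n) :=
  BddMeasurable.sum fun i _ => bddMeasurable_psi hm i

theorem bddMeasurable_marcSum (hm : ∀ k, 2 ≤ m k) (n : ℕ) :
    BddMeasurable fun p : VilenkinGroup m × VilenkinGroup m => marcSum m n p.1 p.2 :=
  BddMeasurable.sum fun j _ => ((bddMeasurable_dirichlet hm j).comp measurable_fst).mul
    ((bddMeasurable_dirichlet hm j).comp measurable_snd)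

/-- The reflection $t \mapsto w - t$ gives $\int\psi_n = \psi_n(w)\int\overline{\psi_n}$ for every
$w$. Comparing $w = 0$ with a $w$ where $\psi_n(w) \ne 1$ forces the integral to vanish. -/
theorem integral_psi (hm : ∀ k, 2 ≤ m k) (n : ℕ) :
    ∫ t, psi m n t ∂(haar m) = if n = 0 then 1 else 0 := by
  have := isProbabilityMeasure_haar hm
  split_ifs with h
  · simp [h, psi_zero hm]
  · obtain ⟨z, hz⟩ := exists_psi_ne_one hm h
    have key : ∀ w : VilenkinGroup m, ∫ t, psi m n t ∂(haar m) =
        psi m n w * ∫ t, (starRingEnd ℂ) (psi m n t) ∂(haar m) := fun w => by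
      rw [← integral_const_mul, ← integral_comp_of_measurePreserving
        (measurePreserving_sub_left hm w) (bddMeasurable_psi hm n).1.aestronglyMeasurable]
      exact integral_congr_ae (ae_of_all _ fun t => psi_sub hm n w t)
    have h0 := key 0
    have h1 : psi m n 0 = 1 := by
      have h2 := psi_add hm n (0 : VilenkinGroup m) 0
      rw [add_zero] at h2
      have h3 : psi m n (0 : VilenkinGroup m) ≠ 0 := fun h4 => by
        have := norm_psi hm n 0; rw [h4] at this; simp at this
      exact (mul_left_cancel₀ h3 (by rw [mul_one]; exact h2)).symm
    rw [h1, one_mul] at h0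
    have h2 := key z
    rw [← h0] at h2
    have h3 : (psi m n z - 1) * ∫ t, psi m n t ∂(haar m) = 0 := by rw [sub_mul, ← h2]; ring
    exact (mul_eq_zero.1 h3).resolve_left (sub_ne_zero.2 hz)

theorem integral_dirichlet (hm : ∀ k, 2 ≤ m k) (n : ℕ) :
    ∫ t, dirichlet m n t ∂(haar m) = if n = 0 then 0 else 1 := by
  have := isProbabilityMeasure_haar hm
  simp only [dirichlet]
  rw [integral_finsetSum _ fun i _ => (bddMeasurable_psi hm i).integrable]
  simp only [integral_psi hm, Finset.sum_ite_eq', Finset.mem_range]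
  rcases Nat.eq_zero_or_pos n with h | h
  · simp [h]
  · simp [h, h.ne']

theorem integral_marcSum (hm : ∀ k, 2 ≤ m k) (n : ℕ) :
    ∫ p, marcSum m (n + 1) p.1 p.2 ∂(haar₂ m) = n := by
  have := isProbabilityMeasure_haar hm
  have h : ∀ j, Integrable (fun p : VilenkinGroup m × VilenkinGroup m =>
      dirichlet m j p.1 * dirichlet m j p.2) (haar₂ m) := fun j =>
    (bddMeasurable_dirichlet hm j).integrable.mul_prod (bddMeasurable_dirichlet hm j).integrable
  simp only [marcSum]
  rw [integral_finsetSum _ fun j _ => h j]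
  simp only [haar₂, integral_prod_mul, integral_dirichlet hm]
  -- Split off $j = 0$: since $D_0 = 0$, only $n$ of the $n+1$ terms have integral $1$.
  rw [Finset.sum_range_succ']
  simp

theorem partialSum_eq_integral (hm : ∀ k, 2 ≤ m k) {f : VilenkinGroup m × VilenkinGroup m → ℂ}
    (hf : Integrable f (haar₂ m)) (A B : ℕ) (x y : VilenkinGroup m) :
    partialSum m f A B x y =
      ∫ p, f p * (dirichlet m A (x - p.1) * dirichlet m B (y - p.2)) ∂(haar₂ m) := by
  have hψ : ∀ (n : ℕ) (z : VilenkinGroup m), BddMeasurable fun t => psi m n (z - t) :=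
    fun n z => (bddMeasurable_psi hm n).comp (measurePreserving_sub_left hm z).measurable
  have hint : ∀ i j, Integrable (fun p : VilenkinGroup m × VilenkinGroup m =>
      f p * (psi m i (x - p.1) * psi m j (y - p.2))) (haar₂ m) := fun i j =>
    (((hψ i x).comp measurable_fst).mul ((hψ j y).comp measurable_snd)).integrable_mul hf
  have h1 : ∀ p : VilenkinGroup m × VilenkinGroup m,
      f p * (dirichlet m A (x - p.1) * dirichlet m B (y - p.2)) =
      ∑ i ∈ Finset.range A, ∑ j ∈ Finset.range B,
        f p * (psi m i (x - p.1) * psi m j (y - p.2)) := fun p => by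
    rw [dirichlet, dirichlet, Finset.sum_mul_sum]
    simp only [Finset.mul_sum]
  simp only [h1]
  rw [integral_finsetSum _ fun i _ => integrable_finsetSum _ fun j _ => hint i j, partialSum]
  refine Finset.sum_congr rfl fun i _ => ?_
  rw [integral_finsetSum _ fun j _ => hint i j]
  refine Finset.sum_congr rfl fun j _ => ?_
  rw [fourierCoeff, mul_assoc, ← integral_mul_const]
  refine integral_congr_ae (ae_of_all _ fun p => ?_)
  simp only [psi_sub hm, map_mul]
  ring

theorem sigma_eq_integral (hm : ∀ k, 2 ≤ m k) {f : VilenkinGroup m × VilenkinGroup m → ℂ}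
    (hf : Integrable f (haar₂ m)) (n : ℕ) (x y : VilenkinGroup m) :
    sigma m f n x y =
      (1 / (n : ℂ)) * ∫ p, f (x - p.1, y - p.2) * marcSum m n p.1 p.2 ∂(haar₂ m) := by
  have hφ := measurePreserving_sub_left₂ hm x y
  have hD : ∀ (j : ℕ) (z : VilenkinGroup m), BddMeasurable fun t => dirichlet m j (z - t) :=
    fun j z => (bddMeasurable_dirichlet hm j).comp (measurePreserving_sub_left hm z).measurable
  have hint : ∀ j, Integrable (fun p : VilenkinGroup m × VilenkinGroup m =>
      f p * (dirichlet m j (x - p.1) * dirichlet m j (y - p.2))) (haar₂ m) := fun j =>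
    (((hD j x).comp measurable_fst).mul ((hD j y).comp measurable_snd)).integrable_mul hf
  have h := integral_comp_of_measurePreserving hφ
    (integrable_finsetSum (Finset.range n) fun j _ => hint j).aestronglyMeasurable
  rw [integral_finsetSum _ fun j _ => hint j] at h
  rw [sigma]
  simp only [partialSum_eq_integral hm hf]
  rw [← h]
  congr 1
  refine integral_congr_ae (ae_of_all _ fun p => ?_)
  simp only [sub_sub_cancel, marcSum, Finset.mul_sum]

theorem integrable_comp_sub_left (hm : ∀ k, 2 ≤ m k)
    {f : VilenkinGroup m × VilenkinGroup m → ℂ} (hf : Integrable f (haar₂ m))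
    (x y : VilenkinGroup m) :
    Integrable (fun p : VilenkinGroup m × VilenkinGroup m =>
      f (x - p.1, y - p.2) - f (x, y)) (haar₂ m) := by
  have := isProbabilityMeasure_haar hm
  have hfin : IsFiniteMeasure (haar₂ m) := by rw [haar₂]; infer_instance
  exact ((measurePreserving_sub_left₂ hm x y).integrable_comp_of_integrable hf).sub
    (integrable_const _)

/-- The kernel has total mass $n/(n+1)$ rather than $1$; the trailing $-f(x,y)$ is this defect. -/
theorem sigma_sub_eq (hm : ∀ k, 2 ≤ m k) {f : VilenkinGroup m × VilenkinGroup m → ℂ}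
    (hf : Integrable f (haar₂ m)) (n : ℕ) (x y : VilenkinGroup m) :
    sigma m f (n + 1) x y - f (x, y) = (1 / ((n + 1 : ℕ) : ℂ)) *
      ((∫ p, (f (x - p.1, y - p.2) - f (x, y)) * marcSum m (n + 1) p.1 p.2 ∂(haar₂ m))
        - f (x, y)) := by
  have := isProbabilityMeasure_haar hm
  have hfin : IsFiniteMeasure (haar₂ m) := by rw [haar₂]; infer_instance
  have h : ∫ p, f (x - p.1, y - p.2) * marcSum m (n + 1) p.1 p.2 ∂(haar₂ m) =
      ∫ p, (f (x - p.1, y - p.2) - f (x, y)) * marcSum m (n + 1) p.1 p.2 ∂(haar₂ m)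
        + f (x, y) * n := by
    rw [← integral_marcSum hm n, ← integral_const_mul, ← integral_add
      ((bddMeasurable_marcSum hm _).integrable_mul (integrable_comp_sub_left hm hf x y))
      ((bddMeasurable_marcSum hm _).integrable.const_mul _)]
    refine integral_congr_ae (ae_of_all _ fun p => ?_)
    beta_reduce
    ring
  have hn : ((n : ℂ) + 1) ≠ 0 := by exact_mod_cast Nat.succ_ne_zero n
  rw [sigma_eq_integral hm hf, h]
  push_cast
  field_simp
  ring

end Integration

end Vilenkin

namespace Vilenkin

/-! ### The functional $W$ as an integral, and the limit. -/

noncomputable section Functional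

variable {m : ℕ → ℕ}

theorem measurableSet_I (k : ℕ) (z : VilenkinGroup m) : MeasurableSet (I m k z) := by
  have h : I m k z = ⋂ i, ⋂ _ : i < k, (fun y : VilenkinGroup m => y i) ⁻¹' {z i} := by
    ext y; simp [I]
  rw [h]
  exact MeasurableSet.iInter fun i => MeasurableSet.iInter fun _ =>
    measurable_pi_apply i (MeasurableSet.singleton _)

theorem bddMeasurable_cyl (k : ℕ) (z : VilenkinGroup m) : BddMeasurable (cyl m k z) :=
  ⟨measurable_one.indicator (measurableSet_I k z), 1, fun t => by
    rw [Real.norm_of_nonneg (cyl_nonneg k z t)]; exact cyl_le_one k z t⟩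

theorem countable_zmod (n : ℕ) : Countable (ZMod n) := by
  cases n with
  | zero => exact inferInstanceAs (Countable ℤ)
  | succ n => infer_instance

theorem bddMeasurable_rFactor (l : ℕ) :
    BddMeasurable fun p : VilenkinGroup m × VilenkinGroup m => rFactor m l (p.1 + p.2) := by
  refine ⟨?_, m l, fun p => ?_⟩
  · have h : Measurable fun p : VilenkinGroup m × VilenkinGroup m => (p.1 l, p.2 l) :=
      ((measurable_pi_apply l).comp measurable_fst).prodMk
        ((measurable_pi_apply l).comp measurable_snd)
    -- Countability makes the product of the two discrete factors discrete, so any function of the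
    -- two coordinates is measurable.
    have := countable_zmod (m l)
    exact (Measurable.of_discrete (f := fun q : ZMod (m l) × ZMod (m l) =>
      if q.1 + q.2 = 0 then (m l : ℝ) else 0)).comp h
  · rw [Real.norm_of_nonneg (rFactor_nonneg _ _), rFactor]
    split_ifs <;> simp

theorem rProd_eq (hm : ∀ k, 2 ≤ m k) {k j : ℕ} (hk : k < j) (t u : VilenkinGroup m) :
    rProd m (k + 1) (j - 1) t u = ((∏ l ∈ Finset.Ico (k + 1) j, rFactor m l (t + u) : ℝ) : ℂ) := by
  have h : Finset.Icc (k + 1) (j - 1) = Finset.Ico (k + 1) j := by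
    ext l; simp only [Finset.mem_Icc, Finset.mem_Ico]; omega
  rw [rProd, h, Complex.ofReal_prod]
  exact Finset.prod_congr rfl fun l _ => by
    rw [← sum_rademacher_pow_eq_rFactor hm, psi_M hm]

theorem setIntegral_prod_eq (F g : VilenkinGroup m × VilenkinGroup m → ℝ) (k l : ℕ)
    (z w : VilenkinGroup m) :
    ∫ p in I m k z ×ˢ I m l w, (F p : ℂ) * (g p : ℂ) ∂(haar₂ m) =
      ((∫ p, F p * (cyl m k z p.1 * cyl m l w p.2 * g p) ∂(haar₂ m) : ℝ) : ℂ) := by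
  rw [← integral_indicator ((measurableSet_I k z).prod (measurableSet_I l w)),
    ← integral_complex_ofReal]
  refine integral_congr_ae (ae_of_all _ fun p => ?_)
  by_cases h1 : p.1 ∈ I m k z <;> by_cases h2 : p.2 ∈ I m l w <;>
    simp [Set.indicator, cyl, h1, h2]

theorem setIntegral_prod_eq' (F : VilenkinGroup m × VilenkinGroup m → ℝ) (k l : ℕ)
    (z w : VilenkinGroup m) :
    ∫ p in I m k z ×ˢ I m l w, (F p : ℂ) ∂(haar₂ m) =
      ((∫ p, F p * (cyl m k z p.1 * cyl m l w p.2) ∂(haar₂ m) : ℝ) : ℂ) := by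
  simpa using setIntegral_prod_eq F (fun _ => 1) k l z w

/-- Interchange the sums over $q \le k < j$, to match the order of summation in `W`. -/
theorem diagKernel_eq_sum (j : ℕ) (t u : VilenkinGroup m) :
    diagKernel m j t u = ∑ q ∈ Finset.range j, ∑ k ∈ Finset.Ico q j, ∑ v ∈ Finset.Ico 1 (m q),
      (M m q : ℝ) * (M m k : ℝ) ^ 2 * (cyl m k 0 t * cyl m k (v • e m q) u *
        ∏ l ∈ Finset.Ico (k + 1) j, rFactor m l (t + u)) := by
  rw [diagKernel, Finset.sum_comm' (t' := Finset.range j) (s' := fun k => Finset.range (k + 1))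
    (by intro q k; simp only [Finset.mem_range, Finset.mem_Ico]; omega)]
  refine Finset.sum_congr rfl fun k _ => ?_
  simp only [fejerMaj, Finset.mul_sum, Finset.sum_mul]
  exact Finset.sum_congr rfl fun _ _ => Finset.sum_congr rfl fun _ _ => by ring

theorem sideKernel_eq_sum (j : ℕ) (t u : VilenkinGroup m) :
    sideKernel m j t u = ∑ s ∈ Finset.range (j + 1), ∑ i ∈ Finset.Icc s j,
      ∑ v ∈ Finset.Ico 1 (m s), (M m s : ℝ) * (M m i : ℝ) *
        (cyl m j 0 t * cyl m i (v • e m s) u) := by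
  rw [sideKernel, Finset.sum_comm' (t' := Finset.range (j + 1))
    (s' := fun i => Finset.range (i + 1))
    (by intro q k; simp only [Finset.mem_range, Finset.mem_Icc]; omega), Finset.mul_sum]
  refine Finset.sum_congr rfl fun k _ => ?_
  simp only [fejerMaj, Finset.mul_sum]
  exact Finset.sum_congr rfl fun _ _ => Finset.sum_congr rfl fun _ _ => by ring

theorem integral_mul_sum_sum_sum {α : Type*} [MeasurableSpace α] {μ : Measure α} {F : α → ℝ}
    (hF : Integrable F μ) {s : Finset ℕ} {s' s'' : ℕ → Finset ℕ} (a : ℕ → ℕ → ℝ)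
    {g : ℕ → ℕ → ℕ → α → ℝ} (hg : ∀ q k v, BddMeasurable (g q k v)) :
    ∫ p, F p * ∑ q ∈ s, ∑ k ∈ s' q, ∑ v ∈ s'' q, a q k * g q k v p ∂μ =
      ∑ q ∈ s, ∑ k ∈ s' q, ∑ v ∈ s'' q, a q k * ∫ p, F p * g q k v p ∂μ := by
  have hint : ∀ q k v, Integrable (fun p => F p * (a q k * g q k v p)) μ := fun q k v =>
    ((BddMeasurable.const (a q k)).mul (hg q k v)).integrable_mul hF
  simp only [Finset.mul_sum]
  rw [integral_finsetSum _ fun q _ => integrable_finsetSum _ fun k _ =>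
    integrable_finsetSum _ fun v _ => hint q k v]
  refine Finset.sum_congr rfl fun q _ => ?_
  rw [integral_finsetSum _ fun k _ => integrable_finsetSum _ fun v _ => hint q k v]
  refine Finset.sum_congr rfl fun k _ => ?_
  rw [integral_finsetSum _ fun v _ => hint q k v]
  refine Finset.sum_congr rfl fun v _ => ?_
  rw [← integral_const_mul]
  exact integral_congr_ae (ae_of_all _ fun p => by ring)

theorem bddMeasurable_cyl_mul_cyl (k l : ℕ) (z w : VilenkinGroup m) :
    BddMeasurable fun p : VilenkinGroup m × VilenkinGroup m => cyl m k z p.1 * cyl m l w p.2 :=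
  ((bddMeasurable_cyl k z).comp measurable_fst).mul ((bddMeasurable_cyl l w).comp measurable_snd)

theorem bddMeasurable_fejerMaj (k : ℕ) : BddMeasurable (fejerMaj m k) :=
  BddMeasurable.sum fun _ _ => BddMeasurable.sum fun _ _ =>
    (BddMeasurable.const _).mul (bddMeasurable_cyl _ _)

theorem bddMeasurable_diagKernel (j : ℕ) :
    BddMeasurable fun p : VilenkinGroup m × VilenkinGroup m => diagKernel m j p.1 p.2 :=
  BddMeasurable.sum fun k _ => ((BddMeasurable.const _).mul
    (((bddMeasurable_cyl k 0).comp measurable_fst).mul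
      ((bddMeasurable_fejerMaj k).comp measurable_snd))).mul
    (BddMeasurable.prod fun l _ => bddMeasurable_rFactor l)

theorem bddMeasurable_sideKernel (j : ℕ) :
    BddMeasurable fun p : VilenkinGroup m × VilenkinGroup m => sideKernel m j p.1 p.2 :=
  ((bddMeasurable_cyl j 0).comp measurable_fst).mul (BddMeasurable.sum fun i _ =>
    (BddMeasurable.const _).mul ((bddMeasurable_fejerMaj i).comp measurable_snd))

theorem bddMeasurable_wKernel (j : ℕ) :
    BddMeasurable fun p : VilenkinGroup m × VilenkinGroup m => wKernel m j p.1 p.2 :=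
  ((((BddMeasurable.const _).mul (bddMeasurable_diagKernel j)).add
    ((BddMeasurable.const _).mul ((bddMeasurable_diagKernel j).comp measurable_swap))).add
    (bddMeasurable_sideKernel j)).add ((bddMeasurable_sideKernel j).comp measurable_swap)

/-- The character sums are real, equal to $m_l$ or $0$, so all four terms are real integrals. The
second and fourth come from the first and third by swapping the variables, as $r$ depends only on
$t+u$. -/
theorem W_eq_integral (hm : ∀ k, 2 ≤ m k) {f : VilenkinGroup m × VilenkinGroup m → ℂ}
    (hf : Integrable f (haar₂ m)) (j : ℕ) (x y : VilenkinGroup m) :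
    W m f j x y = ((∫ p, ‖f (x - p.1, y - p.2) - f (x, y)‖ * wKernel m j p.1 p.2 ∂(haar₂ m) : ℝ)
      : ℂ) := by
  have hF := (integrable_comp_sub_left hm hf x y).norm
  rw [W]
  set F : VilenkinGroup m × VilenkinGroup m → ℝ :=
    fun p => ‖f (x - p.1, y - p.2) - f (x, y)‖
  have hR : ∀ k, BddMeasurable fun p : VilenkinGroup m × VilenkinGroup m =>
      ∏ l ∈ Finset.Ico (k + 1) j, rFactor m l (p.1 + p.2) := fun k =>
    BddMeasurable.prod fun l _ => bddMeasurable_rFactor l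
  have e1 : ∑ q ∈ Finset.range j, ∑ k ∈ Finset.Ico q j, ∑ u ∈ Finset.Ico 1 (m q),
      (M m q : ℂ) * (M m k : ℂ) ^ 2 * ∫ p in I m k 0 ×ˢ I m k (u • e m q),
        ((F p : ℝ) : ℂ) * rProd m (k + 1) (j - 1) p.1 p.2 ∂(haar₂ m) =
      ((∫ p, F p * diagKernel m j p.1 p.2 ∂(haar₂ m) : ℝ) : ℂ) := by
    simp only [diagKernel_eq_sum]
    rw [integral_mul_sum_sum_sum hF (fun q k => (M m q : ℝ) * (M m k : ℝ) ^ 2)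
      fun q k v => (bddMeasurable_cyl_mul_cyl k k 0 (v • e m q)).mul (hR k)]
    push_cast
    refine Finset.sum_congr rfl fun q _ => Finset.sum_congr rfl fun k hk =>
      Finset.sum_congr rfl fun v _ => ?_
    simp only [rProd_eq hm (Finset.mem_Ico.1 hk).2]
    rw [setIntegral_prod_eq]
  have e2 : ∑ q ∈ Finset.range j, ∑ k ∈ Finset.Ico q j, ∑ t ∈ Finset.Ico 1 (m q),
      (M m q : ℂ) * (M m k : ℂ) ^ 2 * ∫ p in I m k (t • e m q) ×ˢ I m k 0,
        ((F p : ℝ) : ℂ) * rProd m (k + 1) (j - 1) p.1 p.2 ∂(haar₂ m) =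
      ((∫ p, F p * diagKernel m j p.2 p.1 ∂(haar₂ m) : ℝ) : ℂ) := by
    simp only [diagKernel_eq_sum, mul_comm (cyl m _ 0 _) (cyl m _ (_ • _) _), add_comm (Prod.snd _)]
    rw [integral_mul_sum_sum_sum hF (fun q k => (M m q : ℝ) * (M m k : ℝ) ^ 2)
      fun q k v => (bddMeasurable_cyl_mul_cyl k k (v • e m q) 0).mul (hR k)]
    push_cast
    refine Finset.sum_congr rfl fun q _ => Finset.sum_congr rfl fun k hk =>
      Finset.sum_congr rfl fun v _ => ?_
    simp only [rProd_eq hm (Finset.mem_Ico.1 hk).2]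
    rw [setIntegral_prod_eq]
  have e3 : ∑ s ∈ Finset.range (j + 1), ∑ i ∈ Finset.Icc s j, ∑ u ∈ Finset.Ico 1 (m s),
      (M m s : ℂ) * (M m i : ℂ) * ∫ p in I m j 0 ×ˢ I m i (u • e m s),
        ((F p : ℝ) : ℂ) ∂(haar₂ m) =
      ((∫ p, F p * sideKernel m j p.1 p.2 ∂(haar₂ m) : ℝ) : ℂ) := by
    simp only [sideKernel_eq_sum]
    rw [integral_mul_sum_sum_sum hF (fun s i => (M m s : ℝ) * (M m i : ℝ))
      fun s i v => bddMeasurable_cyl_mul_cyl j i 0 (v • e m s)]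
    push_cast
    simp only [setIntegral_prod_eq']
  have e4 : ∑ s ∈ Finset.range (j + 1), ∑ i ∈ Finset.Icc s j, ∑ t ∈ Finset.Ico 1 (m s),
      (M m s : ℂ) * (M m i : ℂ) * ∫ p in I m i (t • e m s) ×ˢ I m j 0,
        ((F p : ℝ) : ℂ) ∂(haar₂ m) =
      ((∫ p, F p * sideKernel m j p.2 p.1 ∂(haar₂ m) : ℝ) : ℂ) := by
    simp only [sideKernel_eq_sum, mul_comm (cyl m _ 0 _) (cyl m _ (_ • _) _)]
    rw [integral_mul_sum_sum_sum hF (fun s i => (M m s : ℝ) * (M m i : ℝ))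
      fun s i v => bddMeasurable_cyl_mul_cyl i j (v • e m s) 0]
    push_cast
    simp only [setIntegral_prod_eq']
  rw [e1, e2, e3, e4]
  have i1 := (bddMeasurable_diagKernel (m := m) j).integrable_mul hF
  have i2 : Integrable (fun p => F p * diagKernel m j p.2 p.1) (haar₂ m) :=
    ((bddMeasurable_diagKernel (m := m) j).comp measurable_swap).integrable_mul hF
  have i3 := (bddMeasurable_sideKernel (m := m) j).integrable_mul hF
  have i4 : Integrable (fun p => F p * sideKernel m j p.2 p.1) (haar₂ m) :=
    ((bddMeasurable_sideKernel (m := m) j).comp measurable_swap).integrable_mul hF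
  have i12 : Integrable (fun p => (M m j : ℝ)⁻¹ * (F p * diagKernel m j p.1 p.2)
      + (M m j : ℝ)⁻¹ * (F p * diagKernel m j p.2 p.1)) (haar₂ m) :=
    (i1.const_mul _).add (i2.const_mul _)
  have i123 : Integrable (fun p => (M m j : ℝ)⁻¹ * (F p * diagKernel m j p.1 p.2)
      + (M m j : ℝ)⁻¹ * (F p * diagKernel m j p.2 p.1) + F p * sideKernel m j p.1 p.2)
      (haar₂ m) := i12.add i3
  have hsum : ∫ p, F p * wKernel m j p.1 p.2 ∂(haar₂ m) =
      (M m j : ℝ)⁻¹ * (∫ p, F p * diagKernel m j p.1 p.2 ∂(haar₂ m))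
      + (M m j : ℝ)⁻¹ * (∫ p, F p * diagKernel m j p.2 p.1 ∂(haar₂ m))
      + (∫ p, F p * sideKernel m j p.1 p.2 ∂(haar₂ m))
      + ∫ p, F p * sideKernel m j p.2 p.1 ∂(haar₂ m) := by
    rw [← integral_const_mul, ← integral_const_mul,
      ← integral_add (i1.const_mul _) (i2.const_mul _),
      ← integral_add i12 i3, ← integral_add i123 i4]
    refine integral_congr_ae (ae_of_all _ fun p => ?_)
    simp only [wKernel]
    ring
  rw [hsum]
  push_cast
  rfl

theorem norm_sigma_sub_le (hm : ∀ k, 2 ≤ m k) {B : ℕ} (hB : ∀ k, m k ≤ B)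
    {f : VilenkinGroup m × VilenkinGroup m → ℂ} (hf : Integrable f (haar₂ m))
    (x y : VilenkinGroup m) {n N : ℕ} (hn : n + 1 < M m N) :
    ‖sigma m f (n + 1) x y - f (x, y)‖ ≤ (1 / ((n + 1 : ℕ) : ℝ)) *
      (5 * (B : ℝ) ^ 5 * ∑ A ∈ Finset.range N, (M m A : ℝ) * (W m f A x y).re + ‖f (x, y)‖) := by
  have hF := (integrable_comp_sub_left hm hf x y).norm
  have hint : ∀ A, Integrable (fun p : VilenkinGroup m × VilenkinGroup m =>
      ‖f (x - p.1, y - p.2) - f (x, y)‖ * wKernel m A p.1 p.2) (haar₂ m) := fun A =>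
    (bddMeasurable_wKernel A).integrable_mul hF
  rw [sigma_sub_eq hm hf, norm_mul, norm_div, norm_one, Complex.norm_natCast]
  refine mul_le_mul_of_nonneg_left ((norm_sub_le _ _).trans (add_le_add_left ?_ _))
    (by positivity)
  have h : 5 * (B : ℝ) ^ 5 * ∑ A ∈ Finset.range N, (M m A : ℝ) * (W m f A x y).re =
      ∫ p, 5 * (B : ℝ) ^ 5 * ∑ A ∈ Finset.range N, (M m A : ℝ) *
        (‖f (x - p.1, y - p.2) - f (x, y)‖ * wKernel m A p.1 p.2) ∂(haar₂ m) := by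
    rw [integral_const_mul, integral_finsetSum _ fun A _ => (hint A).const_mul _]
    simp only [integral_const_mul, W_eq_integral hm hf, Complex.ofReal_re]
  rw [h]
  refine norm_integral_le_of_norm_le
    ((integrable_finsetSum _ fun A _ => (hint A).const_mul _).const_mul _)
    (ae_of_all _ fun p => ?_)
  rw [norm_mul]
  refine (mul_le_mul_of_nonneg_left (norm_marcSum_le hm hB hn p.1 p.2) (norm_nonneg _)).trans
    (le_of_eq ?_)
  simp only [Finset.mul_sum]
  exact Finset.sum_congr rfl fun _ _ => by ring

/-- A Cesàro argument: the weights have divergent sum, so $\sum M_A w_A = o(\sum M_A)$, and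
geometric growth bounds $\sum_{A<N} M_A$ by $2M_{N-1} \le 2(n+1)$. -/
theorem tendsto_weighted_mean (hm : ∀ k, 2 ≤ m k) {w : ℕ → ℝ} (hw : Tendsto w atTop (𝓝 0))
    {N : ℕ → ℕ} (hN : Tendsto N atTop atTop) (hle : ∀ n, M m (N n - 1) ≤ n + 1) :
    Tendsto (fun n : ℕ => (1 / ((n + 1 : ℕ) : ℝ)) *
      ∑ A ∈ Finset.range (N n), (M m A : ℝ) * w A) atTop (𝓝 0) := by
  have h1 : (fun A => (M m A : ℝ) * w A) =o[atTop] fun A => (M m A : ℝ) := by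
    have := (Asymptotics.isBigO_refl (fun A => (M m A : ℝ)) atTop).mul_isLittleO
      ((Asymptotics.isLittleO_one_iff ℝ).2 hw)
    simpa using this
  have hdiv : Tendsto (fun n => ∑ A ∈ Finset.range n, (M m A : ℝ)) atTop atTop := by
    refine tendsto_atTop_mono (fun n => ?_) tendsto_natCast_atTop_atTop
    calc (n : ℝ) = ∑ A ∈ Finset.range n, (1 : ℝ) := by simp
      _ ≤ _ := Finset.sum_le_sum fun A _ => by exact_mod_cast M_pos hm A
  have h2 := (h1.sum_range (fun A => Nat.cast_nonneg (M m A)) hdiv).comp_tendsto hN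
  have h3 : (fun n => ∑ A ∈ Finset.range (N n), (M m A : ℝ)) =O[atTop]
      fun n : ℕ => ((n + 1 : ℕ) : ℝ) := by
    refine Asymptotics.IsBigO.of_bound 2 (Eventually.of_forall fun n => ?_)
    rw [Real.norm_of_nonneg (by positivity), Real.norm_of_nonneg (by positivity)]
    have h4 := hle n
    have h5 := sum_M_le hm (N n - 1)
    have h6 : ∑ A ∈ Finset.range (N n), M m A ≤ ∑ A ∈ Finset.range (N n - 1 + 1), M m A :=
      Finset.sum_le_sum_of_subset (Finset.range_mono (by omega))
    have h7 : ∑ A ∈ Finset.range (N n), M m A ≤ 2 * (n + 1) := by omega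
    exact_mod_cast h7
  have h4 := (h2.trans_isBigO h3).tendsto_div_nhds_zero
  refine h4.congr fun n => ?_
  simp only [Function.comp_apply]
  ring

theorem exists_order (hm : ∀ k, 2 ≤ m k) : ∃ N : ℕ → ℕ, Tendsto N atTop atTop ∧
    ∀ n, M m (N n - 1) ≤ n + 1 ∧ n + 1 < M m (N n) := by
  classical
  have hex : ∀ n, ∃ N, n + 1 < M m N := fun n => ⟨n + 1, lt_M hm _⟩
  refine ⟨fun n => Nat.find (hex n), tendsto_atTop.2 fun k => ?_, fun n =>
    ⟨?_, Nat.find_spec (hex n)⟩⟩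
  · filter_upwards [eventually_ge_atTop (M m k)] with n hn
    by_contra h
    have h1 := Nat.find_spec (hex n)
    have h2 := M_mono hm (not_le.1 h).le
    omega
  · have h0 : Nat.find (hex n) ≠ 0 := fun h => by
      have h1 := Nat.find_spec (hex n)
      rw [h] at h1
      simp [M] at h1
    exact not_lt.1 (Nat.find_min (hex n) (Nat.sub_lt (Nat.pos_of_ne_zero h0) one_pos))

end Functional

end Vilenkin

theorem theorem1 (m : ℕ → ℕ) (hm : ∀ k, 2 ≤ m k) (hbdd : ∃ B : ℕ, ∀ k, m k ≤ B)
    (f : VilenkinGroup m × VilenkinGroup m → ℂ) (hf : Integrable f (Vilenkin.haar₂ m))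
    (x y : VilenkinGroup m) (hxy : Vilenkin.IsMarcinkiewiczLebesguePoint m f x y) :
    Tendsto (fun n : ℕ => Vilenkin.sigma m f n x y) atTop (𝓝 (f (x, y))) := by
  obtain ⟨B, hB⟩ := hbdd
  obtain ⟨N, hN, hMN⟩ := Vilenkin.exists_order hm
  have hw : Tendsto (fun A => (Vilenkin.W m f A x y).re) atTop (𝓝 0) := by
    simpa [Function.comp_def] using (Complex.continuous_re.tendsto 0).comp hxy
  have h1 := (Vilenkin.tendsto_weighted_mean hm hw hN fun n => (hMN n).1).const_mul
    (5 * (B : ℝ) ^ 5)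
  have h2 : Tendsto (fun n : ℕ => (1 / ((n + 1 : ℕ) : ℝ)) * ‖f (x, y)‖) atTop (𝓝 0) := by
    have h3 : Tendsto (fun n : ℕ => 1 / ((n : ℝ) + 1)) atTop (𝓝 0) :=
      tendsto_one_div_add_atTop_nhds_zero_nat
    simpa using h3.mul_const ‖f (x, y)‖
  -- Pass to $\sigma_{n+1}$, the form in which the error estimate is available.
  rw [← tendsto_add_atTop_iff_nat 1, tendsto_iff_norm_sub_tendsto_zero]
  refine squeeze_zero (fun _ => norm_nonneg _)
    (fun n => Vilenkin.norm_sigma_sub_le hm hB hf x y (hMN n).2) ?_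
  have h3 := h1.add h2
  rw [mul_zero, add_zero] at h3
  refine h3.congr fun n => ?_
  ring
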